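/- For a finite group $G$, let $\mathrm{Irr}_m(G)$ be the set of irreducible complex characters of $G$ that are monomial, that is, of the form $\lambda^G$ for some linear character $\lambda$ of some subgroup of $G$. Call $x\in G$ \emph{monomial-non-vanishing} if $\chi(x)\neq 0$ for every $\chi\in\mathrm{Irr}_m(G)$, let $\mathcal{N}_m(G)$ be the set of all such elements, and let $\mathbf{F}(G)$ be the Fitting subgroup of $G$ (its largest normal nilpotent subgroup). \textbf{Proposition.} Let $G$ be a finite solvable group and let $x\in\mathcal{N}_m(G)$. Then the order of the coset $\mathbf{F}(G)x$ in the quotient group $G/\mathbf{F}(G)$ is a power of $2$ (possibly $1$). In particular, the conjecture that $\mathcal{N}_m(G)\subseteq\mathbf{F}(G)$ for every finite solvable group $G$ holds for groups of odd order: if $G$ is a finite solvable group of odd order, then $\mathcal{N}_m(G)\subseteq\mathbf{F}(G)$. -/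

import Mathlib

/-- The Fitting subgroup `F(G)`: the subgroup generated by all normal nilpotent subgroups of `G`.
For finite `G` it is the largest normal nilpotent subgroup of `G`. -/
def fittingSubgroup (G : Type*) [Group G] : Subgroup G :=
  sSup {N : Subgroup G | N.Normal ∧ Group.IsNilpotent N}

instance fittingSubgroup_normal (G : Type*) [Group G] : (fittingSubgroup G).Normal := by
  unfold fittingSubgroup
  exact Subgroup.sSup_normal _ fun _ hN => hN.1

/-- `Irr(G)`: the set of characters of irreducible complex representations of `G`. Every
finite-dimensional representation is isomorphic to one on some `ℂⁿ`. -/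
def irrChars (G : Type*) [Group G] : Set (G → ℂ) :=
  {χ | ∃ (n : ℕ) (ρ : Representation ℂ G (Fin n → ℂ)), ρ.IsIrreducible ∧ ρ.character = χ}

open Classical in
/-- The induced class function `φ^G` of a class function `φ` on a subgroup `H` of a finite group:
`φ^G(g) = |H|⁻¹ ∑_{t ∈ G} φ°(t⁻¹ g t)`, where `φ°` agrees with `φ` on `H` and is `0` outside `H`. -/
noncomputable def inducedClassFunction {G : Type*} [Group G] (H : Subgroup G) (φ : H → ℂ) :
    G → ℂ := fun g =>
  (Nat.card H : ℂ)⁻¹ * ∑ᶠ t : G, if h : t⁻¹ * g * t ∈ H then φ ⟨t⁻¹ * g * t, h⟩ else 0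

/-- `Irr_m(G)`: the irreducible monomial characters of a finite group `G`, i.e. the irreducible
characters that are induced from a linear character `lam` of some subgroup `H` of `G`. -/
def irrMonomialChars (G : Type*) [Group G] : Set (G → ℂ) :=
  {χ | χ ∈ irrChars G ∧ ∃ (H : Subgroup G) (lam : H →* ℂˣ),
    χ = inducedClassFunction H fun h => (lam h : ℂ)}

/-- `N_m(G)`: the monomial-non-vanishing elements of `G`, on which no irreducible monomial
character of `G` vanishes. -/
def monomialNonvanishing (G : Type*) [Group G] : Set G :=
  {g | ∀ χ ∈ irrMonomialChars G, χ g ≠ 0}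

/-! Induct on |G| to show that some `x ^ 2 ^ k` lies in F(G). Monomial non-vanishing passes to
quotients, and membership in F(G) can be tested modulo two normal subgroups that meet trivially, or
modulo a normal subgroup of the Frattini subgroup. What remains is G = M ⋊ L with M minimal normal
and abelian, and L acting faithfully and irreducibly on M, hence on its dual. A linear character λ
of M extends to its stabilizer T because the extension splits, and by Clifford theory the extension
induces irreducibly to G. That character is monomial, so it is nonzero at x, and a conjugate of x
lies in T. Hence every λ is stabilized by some conjugate of x.

If the image of x in L is not of 2-power order, induction yields a power y of it that has odd prime
order p and lies in a normal p-subgroup P of L. The orbit theorem `exists_forall_conj_smul_ne`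
provides a λ that no conjugate of y fixes, a contradiction.

The orbit theorem, for an irreducible H-module V, goes by induction on |V|. If a nontrivial element
of an abelian normal subgroup of H inside P fixes a nonzero vector, V is induced from a smaller
module and the vector is built from one there. Otherwise let Ω be the set of elements of order
dividing p in the second centre of P, a subgroup since p is odd. Its centre acts fixed point freely,
so it is cyclic of order p. The commutator pairing on Ω modulo its centre is then perfect, which
gives P = Ω C_P(Ω), and Ω contains every element of order p of P. Since Ω has class at most two, it
has a regular orbit on V, and no conjugate of y fixes a vector of that orbit. -/

/-! ### Elements of order p in p-groups, p odd -/

section OddPGroups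

open scoped commutatorElement

variable {P : Type*} [Group P]

/-- Sorting the word needs `n.choose 2` exchanges of a `b` with a later `a`, each at the cost of one
factor `c`. -/
theorem mul_pow_of_mul_eq_mul_mul {a b c : P} (h : b * a = a * b * c) (ha : Commute c a)
    (hb : Commute c b) (n : ℕ) : (a * b) ^ n = a ^ n * b ^ n * c ^ n.choose 2 := by
  have key : ∀ n : ℕ, b ^ n * a = a * b ^ n * c ^ n := by
    intro n
    induction n with
    | zero => simp
    | succ n ih =>
      calc b ^ (n + 1) * a = b ^ n * (b * a) := by rw [pow_succ, mul_assoc]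
        _ = (b ^ n * a) * (b * c) := by rw [h]; group
        _ = a * b ^ n * (c ^ n * b) * c := by rw [ih]; group
        _ = a * b ^ n * (b * c ^ n) * c := by rw [(hb.pow_left n).eq]
        _ = a * b ^ (n + 1) * c ^ (n + 1) := by rw [pow_succ, pow_succ]; group
  induction n with
  | zero => simp
  | succ n ih =>
    have h2 : (n + 1).choose 2 = n + n.choose 2 := by
      rw [Nat.choose_succ_succ' n 1, Nat.choose_one_right]
    have hab : Commute (c ^ n.choose 2) (a * b) := (ha.mul_right hb).pow_left _
    calc (a * b) ^ (n + 1) = a ^ n * b ^ n * (c ^ n.choose 2 * (a * b)) := by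
          rw [pow_succ, ih]; group
      _ = a ^ n * (b ^ n * a) * b * c ^ n.choose 2 := by rw [hab.eq]; group
      _ = a ^ n * a * b ^ n * (c ^ n * b) * c ^ n.choose 2 := by rw [key]; group
      _ = a ^ n * a * b ^ n * (b * c ^ n) * c ^ n.choose 2 := by rw [(hb.pow_left n).eq]
      _ = a ^ (n + 1) * b ^ (n + 1) * c ^ (n + 1).choose 2 := by
          rw [h2, pow_add, pow_succ, pow_succ]; group

theorem commutatorElement_mul_left_of_mem_center {a b g : P} (h : ⁅b, g⁆ ∈ Subgroup.center P) :
    ⁅a * b, g⁆ = ⁅a, g⁆ * ⁅b, g⁆ := by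
  have h1 : ⁅a * b, g⁆ = a * ⁅b, g⁆ * a⁻¹ * ⁅a, g⁆ := by
    simp only [commutatorElement_def]; group
  rw [h1, Subgroup.mem_center_iff.1 h a, mul_inv_cancel_right, Subgroup.mem_center_iff.1 h]

theorem commutatorElement_mul_right_of_mem_center {a g h : P} (hc : ⁅a, h⁆ ∈ Subgroup.center P) :
    ⁅a, g * h⁆ = ⁅a, g⁆ * ⁅a, h⁆ := by
  have h1 : ⁅a, g * h⁆ = ⁅a, g⁆ * (g * ⁅a, h⁆ * g⁻¹) := by
    simp only [commutatorElement_def]; group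
  rw [h1, Subgroup.mem_center_iff.1 hc g, mul_inv_cancel_right]

theorem commutatorElement_pow_left_of_mem_center {a g : P} (h : ⁅a, g⁆ ∈ Subgroup.center P)
    (n : ℕ) : ⁅a ^ n, g⁆ = ⁅a, g⁆ ^ n := by
  induction n with
  | zero => simp
  | succ n ih => rw [pow_succ, commutatorElement_mul_left_of_mem_center h, ih, pow_succ]

theorem commute_inv_mul_of_commutatorElement_eq {u g h : P} (H : ⁅u, g⁆ = ⁅u, h⁆) :
    Commute u (g⁻¹ * h) := by
  simp only [commutatorElement_def, mul_assoc, mul_right_inj] at H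
  have h1 : g * u * g⁻¹ = h * u * h⁻¹ := by
    rw [← inv_inj]
    simpa [mul_assoc] using H
  have h2 := congrArg (fun t => g⁻¹ * t * h) h1
  simpa [Commute, SemiconjBy, mul_assoc] using h2

/-- The elements of order dividing the odd number `p` in the second centre of `P`. -/
def omegaSecondCenter (P : Type*) [Group P] (p : ℕ) (hp : Odd p) : Subgroup P where
  carrier := {u | u ^ p = 1 ∧ ∀ g : P, ⁅u, g⁆ ∈ Subgroup.center P}
  one_mem' := ⟨one_pow _, fun g => by simp⟩
  mul_mem' := by
    rintro a b ⟨ha, ha'⟩ ⟨hb, hb'⟩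
    refine ⟨?_, fun g => ?_⟩
    · have hc := hb' a
      have hcp : ⁅b, a⁆ ^ p = 1 := by
        rw [← commutatorElement_pow_left_of_mem_center hc, hb, commutatorElement_one_left]
      have h1 : b * a = a * b * ⁅b, a⁆ := by
        rw [Subgroup.mem_center_iff.1 hc, commutatorElement_def]; group
      rw [mul_pow_of_mul_eq_mul_mul h1 (Subgroup.mem_center_iff.1 hc a).symm
        (Subgroup.mem_center_iff.1 hc b).symm, ha, hb]
      -- For odd `p` the exponent `p.choose 2` is a multiple of `p`, so the commutator factor
      -- vanishes.
      obtain ⟨k, rfl⟩ := hp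
      have : (2 * k + 1).choose 2 = (2 * k + 1) * k := by
        rw [Nat.choose_two_right, Nat.add_sub_cancel, mul_left_comm,
          Nat.mul_div_cancel_left _ two_pos]
      rw [this, pow_mul, hcp]; simp
    · rw [commutatorElement_mul_left_of_mem_center (hb' g)]
      exact mul_mem (ha' g) (hb' g)
  inv_mem' := by
    rintro a ⟨ha, ha'⟩
    refine ⟨by rw [inv_pow, ha, inv_one], fun g => ?_⟩
    have h1 : ⁅a⁻¹, g⁆ = a⁻¹ * ⁅a, g⁆⁻¹ * a := by simp only [commutatorElement_def]; group
    rw [h1, Subgroup.mem_center_iff.1 (inv_mem (ha' g)) a⁻¹, inv_mul_cancel_right]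
    exact inv_mem (ha' g)

/-- Ensures that the image of this subgroup is normal in any group that has `P` as a normal
subgroup. -/
instance omegaSecondCenter_characteristic (p : ℕ) (hp : Odd p) :
    (omegaSecondCenter P p hp).Characteristic := by
  rw [Subgroup.characteristic_iff_le_comap]
  rintro φ u ⟨hu, hu'⟩
  refine ⟨by rw [MulEquiv.coe_toMonoidHom, ← map_pow, hu, map_one], fun g => ?_⟩
  have h1 : ⁅φ u, g⁆ = φ ⁅u, φ.symm g⁆ := by rw [map_commutatorElement, MulEquiv.apply_symm_apply]
  rw [MulEquiv.coe_toMonoidHom, h1, Subgroup.mem_center_iff]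
  intro h
  rw [← φ.apply_symm_apply h, ← map_mul, Subgroup.mem_center_iff.1 (hu' _), map_mul]

/-- In a finite `p`-group, a normal subgroup `N` that is not contained in a central subgroup `Z`
of `N` has an element outside `Z` that is central modulo `Z`. -/
theorem exists_mem_notMem_commutator_mem [Finite P] {p : ℕ} [Fact p.Prime] (hP : IsPGroup p P)
    {N Z : Subgroup P} [N.Normal] (hZ : Z ≤ Subgroup.center P) (h : ¬ N ≤ Z) :
    ∃ u ∈ N, u ∉ Z ∧ ∀ g : P, ⁅u, g⁆ ∈ Z := by
  have : Z.Normal := ⟨fun z hz g => by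
    rw [Subgroup.mem_center_iff.1 (hZ hz) g, mul_inv_cancel_right]; exact hz⟩
  let Q := P ⧸ Z
  let N' : Subgroup Q := N.map (QuotientGroup.mk' Z)
  have : N'.Normal := Subgroup.Normal.map inferInstance _ (QuotientGroup.mk'_surjective Z)
  have hN' : Nontrivial N' := by
    rw [Subgroup.nontrivial_iff_ne_bot]
    intro hb
    apply h
    intro n hn
    have : (QuotientGroup.mk' Z n) ∈ N' := Subgroup.mem_map_of_mem _ hn
    rw [hb, Subgroup.mem_bot] at this
    exact (QuotientGroup.eq_one_iff n).1 this
  have hQ : IsPGroup p (ConjAct Q) := hP.to_quotient Z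
  have hdvd : p ∣ Nat.card N' :=
    ((hP.to_quotient Z).to_subgroup N').card_eq_or_dvd.resolve_left (by
      intro h1; exact absurd hN' (not_nontrivial_iff_subsingleton.2
        (Nat.card_eq_one_iff_unique.1 h1).1))
  -- The number of fixed points of conjugation on `N'` is divisible by `p`; as 1 is one of them,
  -- there is another, a central element of `P ⧸ Z`.
  obtain ⟨b, hb, hb1⟩ := hQ.exists_fixed_point_of_prime_dvd_card_of_fixed_point (α := N') hdvd
    (a := 1) (by intro g; simp)
  obtain ⟨n, hn, hnb⟩ := Subgroup.mem_map.1 b.2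
  refine ⟨n, hn, fun hz => hb1 ?_, fun g => ?_⟩
  · ext
    rw [← hnb]
    exact ((QuotientGroup.eq_one_iff n).2 hz).symm
  · have h2 := hb (ConjAct.toConjAct (QuotientGroup.mk' Z g))
    have h3 := congrArg Subtype.val h2
    rw [ConjAct.Subgroup.val_conj_smul, ConjAct.toConjAct_smul, ← hnb, ← map_inv, ← map_mul, ← map_mul] at h3
    have h4 : ⁅n, g⁆ = n * (g * n * g⁻¹)⁻¹ := by rw [commutatorElement_def]; group
    rw [← QuotientGroup.ker_mk' Z, MonoidHom.mem_ker, h4, map_mul, map_inv, h3, mul_inv_cancel]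

/-- If a finite `p`-group with `p` odd has an element of order `p` outside a central subgroup of
order `p`, then it has one that is moreover in the second centre. -/
theorem exists_mem_omegaSecondCenter {p : ℕ} [Fact p.Prime] (hp : Odd p) :
    ∀ (n : ℕ) (P : Type*) [Group P] [Finite P], Nat.card P = n → IsPGroup p P → ∀ z y : P,
      z ∈ Subgroup.center P → z ^ p = 1 → y ^ p = 1 → y ∉ Subgroup.zpowers z →
      ∃ u ∈ omegaSecondCenter P p hp, u ∉ Subgroup.zpowers z := by
  intro n
  induction n using Nat.strong_induction_on with
  | _ n ih =>
    intro P _ _ hn hP z y hz hzp hy hyz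
    by_cases hyc : y ∈ Subgroup.center P
    · refine ⟨y, ⟨hy, fun g => ?_⟩, hyz⟩
      rw [commutatorElement_def, ← Subgroup.mem_center_iff.1 hyc g, mul_inv_cancel_right,
        mul_inv_cancel]
      exact one_mem _
    have hlt : Subgroup.centralizer {y} ≠ ⊤ := by
      intro h
      apply hyc
      rw [Subgroup.mem_center_iff]
      intro g
      have : g ∈ Subgroup.centralizer {y} := h ▸ Subgroup.mem_top g
      exact Subgroup.mem_centralizer_singleton_iff.1 this
    -- A maximal subgroup `S` above the centralizer of `y` is normal and contains `y` and `z`, so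
    -- the induction hypothesis applies to it.
    obtain ⟨S, hS, hle⟩ := (eq_top_or_exists_le_coatom (Subgroup.centralizer {y})).resolve_left hlt
    have hyS : y ∈ S := hle (Subgroup.mem_centralizer_singleton_iff.2 rfl)
    have hzS : z ∈ S := hle (Subgroup.mem_centralizer_singleton_iff.2
      (Subgroup.mem_center_iff.1 hz y).symm)
    have : Group.IsNilpotent P := hP.isNilpotent
    have hSn : S.Normal := Subgroup.NormalizerCondition.normal_of_coatom S
      Group.normalizerCondition_of_isNilpotent hS
    have hcard : Nat.card S < n := hn ▸ Nat.lt_of_le_of_ne (Subgroup.card_le_card_group S)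
      (fun h => hS.1 (Subgroup.card_eq_iff_eq_top S |>.1 h))
    have hzp' : ∀ w : S, w ∈ Subgroup.zpowers (⟨z, hzS⟩ : S) ↔ (w : P) ∈ Subgroup.zpowers z := by
      intro w
      simp only [Subgroup.mem_zpowers_iff, Subtype.ext_iff, Subgroup.coe_zpow]
    obtain ⟨u, hu, huz⟩ := ih _ hcard S rfl (hP.to_subgroup S) ⟨z, hzS⟩ ⟨y, hyS⟩
      (Subgroup.mem_center_iff.2 fun g => Subtype.ext (Subgroup.mem_center_iff.1 hz g))
      (Subtype.ext hzp) (Subtype.ext hy) (fun h => hyz ((hzp' _).1 h))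
    -- The subgroup found in `S` is normal in `P`. An element of it that is central modulo `⟨z⟩`
    -- lies in the second centre of `P`.
    obtain ⟨w, hw, hwz, hwc⟩ := exists_mem_notMem_commutator_mem hP
      (N := (omegaSecondCenter S p hp).map S.subtype) (Z := Subgroup.zpowers z)
      (Subgroup.zpowers_le.2 hz)
      (fun h => huz ((hzp' u).2 (h (Subgroup.mem_map_of_mem S.subtype hu))))
    obtain ⟨w', hw', rfl⟩ := Subgroup.mem_map.1 hw
    exact ⟨w', ⟨congrArg Subtype.val hw'.1, fun g => Subgroup.zpowers_le.2 hz (hwc g)⟩, hwz⟩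

/-- A perfect pairing argument: if the centre of `Ω` is the subgroup generated by a central element
`z` of order `p`, where `Ω` denotes the elements of order dividing `p` in the second centre, then
every element of `P` acts on `Ω` by conjugation like some element of `Ω`. -/
theorem exists_mem_omegaSecondCenter_commutator_eq [Finite P] {p : ℕ} [Fact p.Prime] (hp : Odd p)
    {z : P} (hz : z ∈ Subgroup.center P) (hzp : z ^ p = 1) (hz1 : z ≠ 1)
    (hΩ : ∀ u ∈ omegaSecondCenter P p hp, (∀ w ∈ omegaSecondCenter P p hp, Commute u w) →
      u ∈ Subgroup.zpowers z) (g : P) :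
    ∃ w ∈ omegaSecondCenter P p hp, ∀ u ∈ omegaSecondCenter P p hp, ⁅u, w⁆ = ⁅u, g⁆ := by
  set Ω := omegaSecondCenter P p hp with hΩdef
  have hcomm : ∀ u ∈ Ω, ∀ g : P, ⁅u, g⁆ ∈ Subgroup.zpowers z := by
    intro u hu g
    have hc := hu.2 g
    refine hΩ _ ⟨?_, fun h => ?_⟩ fun w _ => (Subgroup.mem_center_iff.1 hc w).symm
    · rw [← commutatorElement_pow_left_of_mem_center hc, hu.1, commutatorElement_one_left]
    · rw [commutatorElement_eq_one_iff_mul_comm.2 (Subgroup.mem_center_iff.1 hc h).symm]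
      exact one_mem _
  let _ : CommGroup (Subgroup.center P) := { (inferInstance : Group (Subgroup.center P)) with
    mul_comm := fun a b => Subtype.ext (Subgroup.mem_center_iff.1 b.2 a) }
  -- `χ` is faithful on `⟨z⟩`, which has prime order and contains all commutators of `Ω` with `P`.
  -- It turns them into complex numbers without loss.
  obtain ⟨χ, hχ⟩ := CommGroup.exists_apply_ne_one_of_hasEnoughRootsOfUnity (Subgroup.center P) ℂ
    (a := ⟨z, hz⟩) (fun h => hz1 (congrArg Subtype.val h))
  have hinj : ∀ c : Subgroup.center P, (c : P) ∈ Subgroup.zpowers z → χ c = 1 → c = 1 := by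
    intro c hc hc1
    obtain ⟨k, hk⟩ := Subgroup.mem_zpowers_iff.1 hc
    have hck : c = (⟨z, hz⟩ : Subgroup.center P) ^ k := Subtype.ext hk.symm
    rw [hck, map_zpow] at hc1
    have hχp : χ ⟨z, hz⟩ ^ p = 1 := by
      rw [← map_pow, ← map_one χ]
      exact congrArg χ (Subtype.ext hzp)
    have hord : orderOf (χ ⟨z, hz⟩) = p := orderOf_eq_prime hχp hχ
    have hdvd : (p : ℤ) ∣ k := hord ▸ orderOf_dvd_iff_zpow_eq_one.2 hc1
    obtain ⟨m, rfl⟩ := hdvd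
    ext
    rw [← hk, zpow_mul, zpow_natCast, hzp, one_zpow]
    rfl
  let θ : P → Ω →* ℂˣ := fun g =>
    { toFun := fun u => χ ⟨⁅(u : P), g⁆, u.2.2 g⟩
      map_one' := by
        rw [← map_one χ]
        exact congrArg χ (Subtype.ext (commutatorElement_one_left g))
      map_mul' := fun u v => by
        rw [← map_mul]
        exact congrArg χ (Subtype.ext (commutatorElement_mul_left_of_mem_center (v.2.2 g))) }
  have hθ : ∀ g h : P, θ g = θ h → ∀ u ∈ Ω, ⁅u, g⁆ = ⁅u, h⁆ := by
    intro g h hgh u hu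
    have h1 : χ (⟨⁅u, g⁆, hu.2 g⟩ * (⟨⁅u, h⁆, hu.2 h⟩)⁻¹) = 1 := by
      rw [map_mul, map_inv, mul_inv_eq_one]
      exact DFunLike.congr_fun hgh ⟨u, hu⟩
    have h2 := hinj _ (mul_mem (hcomm u hu g) (inv_mem (hcomm u hu h))) h1
    exact congrArg Subtype.val (mul_inv_eq_one.1 h2)
  let Q := Ω ⧸ Subgroup.center Ω
  have hcen : ∀ g : P, Subgroup.center Ω ≤ (θ g).ker := by
    intro g u hu
    have hu' : (u : P) ∈ Subgroup.center P := Subgroup.zpowers_le.2 hz (hΩ u u.2 fun w hw =>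
      (congrArg Subtype.val (Subgroup.mem_center_iff.1 hu ⟨w, hw⟩)).symm)
    rw [MonoidHom.mem_ker, ← map_one χ]
    exact congrArg χ (Subtype.ext (commutatorElement_eq_one_iff_mul_comm.2
      (Subgroup.mem_center_iff.1 hu' g).symm))
  let _ : CommGroup Q := { (inferInstance : Group Q) with
    mul_comm := by
      intro a b
      induction a using QuotientGroup.induction_on with | _ a
      induction b using QuotientGroup.induction_on with | _ b
      rw [← QuotientGroup.mk_mul, ← QuotientGroup.mk_mul, QuotientGroup.eq, Subgroup.mem_center_iff]
      intro c
      have h1 : (a * b)⁻¹ * (b * a) = ⁅b⁻¹, a⁻¹⁆ := by rw [commutatorElement_def]; group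
      rw [h1]
      exact Subtype.ext (Subgroup.mem_center_iff.1 ((b⁻¹).2.2 _) c) }
  -- The pairing embeds `Q` into its dual, which has the same cardinality, so `f` is onto. In
  -- particular it hits the character `u ↦ χ ⁅u, g⁆` for an arbitrary `g` in `P`.
  let f : Q → (Q →* ℂˣ) := fun q => QuotientGroup.lift _ (θ (q.out : Ω)) (hcen _)
  have hf : Function.Injective f := by
    intro q r hqr
    have h1 : θ (q.out : Ω) = θ (r.out : Ω) := by
      ext u
      exact congrArg Units.val (DFunLike.congr_fun hqr (QuotientGroup.mk u))
    rw [← q.out_eq', ← r.out_eq']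
    refine QuotientGroup.eq.2 (Subgroup.mem_center_iff.2 fun u => Subtype.ext ?_)
    exact (commute_inv_mul_of_commutatorElement_eq (hθ _ _ h1 u u.2)).eq
  have hcard : Nat.card (Q →* ℂˣ) = Nat.card Q :=
    CommGroup.card_monoidHom_of_hasEnoughRootsOfUnity Q ℂ
  have hfin : Finite (Q →* ℂˣ) := Nat.finite_of_card_ne_zero (hcard ▸ Nat.card_pos.ne')
  obtain ⟨q, hq⟩ := (hf.bijective_of_nat_card_le hcard.le).2 (QuotientGroup.lift _ (θ g) (hcen g))
  refine ⟨(q.out : Ω), (q.out : Ω).2, hθ _ _ ?_⟩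
  ext u
  exact congrArg Units.val (DFunLike.congr_fun hq (QuotientGroup.mk u))

/-- Under the same assumption on the centre of `Ω`, the group `P` has no further elements of order
`p`. -/
theorem mem_omegaSecondCenter_of_pow_eq_one [Finite P] {p : ℕ} [Fact p.Prime] (hp : Odd p)
    (hP : IsPGroup p P) {z : P} (hz : z ∈ Subgroup.center P) (hzp : z ^ p = 1) (hz1 : z ≠ 1)
    (hΩ : ∀ u ∈ omegaSecondCenter P p hp, (∀ w ∈ omegaSecondCenter P p hp, Commute u w) →
      u ∈ Subgroup.zpowers z) {y : P} (hy : y ^ p = 1) : y ∈ omegaSecondCenter P p hp := by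
  have hpair := exists_mem_omegaSecondCenter_commutator_eq hp hz hzp hz1 hΩ
  set Ω := omegaSecondCenter P p hp with hΩdef
  let C : Subgroup P := Subgroup.centralizer (Ω : Set P)
  -- P = Ω C: if `w` acts on `Ω` as `g` does, then `w⁻¹ * g` centralizes `Ω`.
  have hdec : ∀ g : P, ∃ w ∈ Ω, ∃ c ∈ C, g = w * c := by
    intro g
    obtain ⟨w, hw, h⟩ := hpair g
    exact ⟨w, hw, w⁻¹ * g, Subgroup.mem_centralizer_iff.2 fun u hu =>
      commute_inv_mul_of_commutatorElement_eq (h u hu), by group⟩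
  obtain ⟨w, hw, c, hc, rfl⟩ := hdec y
  refine mul_mem hw ?_
  have hzC : z ∈ C := Subgroup.mem_centralizer_iff.2 fun u _ => Subgroup.mem_center_iff.1 hz u
  have hcw : Commute c w := (Subgroup.mem_centralizer_iff.1 hc w hw).symm
  have hcp : c ^ p = 1 := by
    rw [hcw.symm.mul_pow, hw.1, one_mul] at hy
    exact hy
  have hzΩ : z ∈ Ω := by
    refine ⟨hzp, fun g => ?_⟩
    rw [commutatorElement_eq_one_iff_mul_comm.2 (Subgroup.mem_center_iff.1 hz g).symm]
    exact one_mem _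
  by_contra hcΩ
  have hzp' : ∀ w : C, w ∈ Subgroup.zpowers (⟨z, hzC⟩ : C) ↔ (w : P) ∈ Subgroup.zpowers z := by
    intro w
    simp only [Subgroup.mem_zpowers_iff, Subtype.ext_iff, Subgroup.coe_zpow]
  -- An element `c` outside `Ω` would yield an element `u` outside `⟨z⟩` in the second centre of
  -- `C`. Since P = Ω C and `u` centralizes `Ω`, it is also in the second centre of `P`, so `u` is
  -- central in `Ω`, a contradiction.
  obtain ⟨u, hu, huz⟩ := exists_mem_omegaSecondCenter hp _ C rfl (hP.to_subgroup C) ⟨z, hzC⟩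
    ⟨c, hc⟩ (Subgroup.mem_center_iff.2 fun g => Subtype.ext (Subgroup.mem_center_iff.1 hz g))
    (Subtype.ext hzp) (Subtype.ext hcp)
    (fun h => hcΩ (Subgroup.zpowers_le.2 hzΩ ((hzp' _).1 h)))
  have hΩC : ∀ (d : C), ∀ w ∈ Ω, Commute (d : P) w := fun d w hw =>
    (Subgroup.mem_centralizer_iff.1 d.2 w hw).symm
  refine huz ((hzp' u).2 (hΩ u ⟨congrArg Subtype.val hu.1, fun g => ?_⟩ (hΩC u)))
  have hcen : ∀ d ∈ C, ⁅(u : P), d⁆ ∈ Subgroup.center P := by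
    intro d hd
    rw [Subgroup.mem_center_iff]
    intro h
    obtain ⟨w, hw, e, he, rfl⟩ := hdec h
    have h1 : e * ⁅(u : P), d⁆ = ⁅(u : P), d⁆ * e :=
      congrArg Subtype.val (Subgroup.mem_center_iff.1 (hu.2 ⟨d, hd⟩) ⟨e, he⟩)
    have h2 : Commute ⁅(u : P), d⁆ w := hΩC ⁅u, ⟨d, hd⟩⁆ w hw
    exact ((Commute.mul_right h2 h1.symm).eq).symm
  obtain ⟨w, hw, d, hd, rfl⟩ := hdec g
  have h1 : ⁅(u : P), w⁆ = 1 := commutatorElement_eq_one_iff_commute.2 (hΩC u w hw)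
  rw [commutatorElement_mul_right_of_mem_center (hcen d hd), h1, one_mul]
  exact hcen d hd

end OddPGroups

/-! ### Fixed spaces and norm maps of subgroups -/

section NormSums

open scoped commutatorElement Pointwise

variable {H V : Type*} [Group H] [AddCommGroup V] [DistribMulAction H V]

/-- The vectors fixed by a subgroup. -/
def fixedVectors (V : Type*) [AddCommGroup V] [DistribMulAction H V] (B : Subgroup H) :
    AddSubgroup V where
  carrier := {v | ∀ b ∈ B, b • v = v}
  zero_mem' := fun b _ => smul_zero b
  add_mem' := fun hv hw b hb => by rw [smul_add, hv b hb, hw b hb]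
  neg_mem' := fun hv b hb => by rw [smul_neg, hv b hb]

theorem mem_conj_smul_iff {B : Subgroup H} {g x : H} :
    x ∈ MulAut.conj g • B ↔ g⁻¹ * x * g ∈ B := by
  rw [Subgroup.mem_pointwise_smul_iff_inv_smul_mem, ← map_inv, MulAut.smul_def, MulAut.conj_apply,
    inv_inv]

theorem smul_mem_fixedVectors_conj {B : Subgroup H} {v : V} (hv : v ∈ fixedVectors V B) (g : H) :
    g • v ∈ fixedVectors V (MulAut.conj g • B) := by
  intro x hx
  have h1 := hv _ (mem_conj_smul_iff.1 hx)
  rw [← smul_smul, ← smul_smul, inv_smul_eq_iff] at h1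
  exact h1

theorem card_nsmul_injective_of_dvd {m n : ℕ} (h : m ∣ n) (hn : ∀ v : V, n • v = 0 → v = 0)
    (v : V) (hv : m • v = 0) : v = 0 := by
  obtain ⟨k, rfl⟩ := h
  exact hn v (by rw [mul_comm, mul_smul, hv, smul_zero])

/-- Applying `g` permutes the terms cyclically, so the sum is a fixed vector. -/
theorem sum_range_pow_smul_eq_zero {g : H} {p : ℕ} (hg : g ^ p = 1)
    (hfree : ∀ v : V, g • v = v → v = 0) (v : V) : ∑ j ∈ Finset.range p, g ^ j • v = 0 := by
  apply hfree
  rw [Finset.smul_sum]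
  have h1 := Finset.sum_range_succ (fun j => g ^ j • v) p
  rw [Finset.sum_range_succ', hg, pow_zero] at h1
  simpa [smul_smul, pow_succ'] using add_right_cancel h1

/-- A noncyclic group of order `p²` cannot act fixed point freely. -/
theorem mem_zpowers_of_fixedPointFree {p : ℕ} [Fact p.Prime] [Nontrivial V] {a b : H}
    (hab : Commute a b) (ha : a ^ p = 1) (hb : b ^ p = 1) (hb1 : b ≠ 1)
    (hc : ∀ v : V, p • v = 0 → v = 0)
    (hfree : ∀ i j : ℕ, a ^ i * b ^ j ≠ 1 → ∀ v : V, (a ^ i * b ^ j) • v = v → v = 0) :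
    a ∈ Subgroup.zpowers b := by
  by_contra hmem
  obtain ⟨v, hv⟩ := exists_ne (0 : V)
  apply hv
  apply hc
  have hne : ∀ i : ℕ, a * b ^ i ≠ 1 := fun i h => hmem (by
    rw [eq_inv_of_mul_eq_one_left h]
    exact inv_mem (pow_mem (Subgroup.mem_zpowers b) i))
  -- Add the vanishing norms of the subgroups generated by `a * b ^ i`. Collected by the exponent
  -- `j`, the terms with `j = 0` give `p • v`, and those with any other `j` form a translate of the
  -- norm of `b ^ j`, which is zero.
  have h1 : ∑ i ∈ Finset.range p, ∑ j ∈ Finset.range p, (a * b ^ i) ^ j • v = 0 := by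
    refine Finset.sum_eq_zero fun i _ => sum_range_pow_smul_eq_zero ?_ ?_ v
    · rw [(hab.pow_right i).mul_pow, ha, one_mul, ← pow_mul, mul_comm, pow_mul, hb, one_pow]
    · have := hfree 1 i
      rw [pow_one] at this
      exact this (hne i)
  have hp : 0 < p := (Fact.out : p.Prime).pos
  rw [Finset.sum_comm, Finset.sum_eq_single_of_mem 0 (Finset.mem_range.2 hp)] at h1
  · simpa using h1
  · intro j hj hj0
    have h2 : ∀ i, (a * b ^ i) ^ j • v = a ^ j • (b ^ j) ^ i • v := by
      intro i
      rw [(hab.pow_right i).mul_pow, smul_smul, ← pow_mul, ← pow_mul, mul_comm i j]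
    rw [Finset.sum_congr rfl fun i _ => h2 i, ← Finset.smul_sum,
      sum_range_pow_smul_eq_zero, smul_zero]
    · rw [← pow_mul, mul_comm, pow_mul, hb, one_pow]
    · have hbj : b ^ j ≠ 1 := by
        intro h
        have := orderOf_dvd_of_pow_eq_one h
        rw [orderOf_eq_prime hb hb1] at this
        exact absurd (Nat.le_of_dvd (Nat.pos_of_ne_zero hj0) this)
          (not_le.2 (Finset.mem_range.1 hj))
      have := hfree 0 j
      rw [pow_zero, one_mul] at this
      exact this hbj

variable [Finite H]

/-- The sum over a subgroup, as an endomorphism. -/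
noncomputable def subgroupSum (V : Type*) [AddCommGroup V] [DistribMulAction H V] (B : Subgroup H) :
    V →+ V :=
  ∑ b ∈ (Set.toFinite (B : Set H)).toFinset, DistribSMul.toAddMonoidHom V b

theorem subgroupSum_apply (B : Subgroup H) (v : V) :
    subgroupSum V B v = ∑ b ∈ (Set.toFinite (B : Set H)).toFinset, b • v := by
  simp [subgroupSum]

theorem subgroupSum_of_mem {B : Subgroup H} {v : V} (hv : v ∈ fixedVectors V B) :
    subgroupSum V B v = Nat.card B • v := by
  rw [subgroupSum_apply, Finset.sum_congr rfl fun b hb => hv b (by simpa using hb), Finset.sum_const,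
    ← Set.ncard_eq_toFinset_card, ← Nat.card_coe_set_eq]
  rfl

theorem smul_subgroupSum (g : H) (B : Subgroup H) (v : V) :
    g • subgroupSum V B v = subgroupSum V (MulAut.conj g • B) (g • v) := by
  rw [subgroupSum_apply, subgroupSum_apply, Finset.smul_sum]
  refine Finset.sum_nbij' (fun b => g * b * g⁻¹) (fun b => g⁻¹ * b * g) ?_ ?_ ?_ ?_ ?_
  · intro b hb
    rw [Set.Finite.mem_toFinset, SetLike.mem_coe] at hb ⊢
    rw [mem_conj_smul_iff]
    simpa [mul_assoc] using hb
  · intro b hb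
    rw [Set.Finite.mem_toFinset, SetLike.mem_coe] at hb ⊢
    rwa [mem_conj_smul_iff] at hb
  · intro b _; group
  · intro b _; group
  · intro b _; simp [smul_smul]

theorem subgroupSum_mem (B : Subgroup H) (v : V) : subgroupSum V B v ∈ fixedVectors V B := by
  intro g hg
  rw [subgroupSum_apply, Finset.smul_sum]
  refine Finset.sum_nbij' (fun b => g * b) (fun b => g⁻¹ * b) ?_ ?_ ?_ ?_ ?_
  · intro b hb
    simpa using mul_mem hg (by simpa using hb)
  · intro b hb
    simpa using mul_mem (inv_mem hg) (by simpa using hb)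
  · intro b _; group
  · intro b _; group
  · intro b _; simp [smul_smul]

theorem subgroupSum_mem_of_normalizing {B B' : Subgroup H} (h : ∀ b ∈ B, ∀ b' ∈ B', b⁻¹ * b' * b ∈ B')
    {v : V} (hv : v ∈ fixedVectors V B') : subgroupSum V B v ∈ fixedVectors V B' := by
  rw [subgroupSum_apply]
  refine sum_mem fun b hb b' hb' => ?_
  have := hv _ (h b (by simpa using hb) b' hb')
  rwa [← smul_smul, ← smul_smul, inv_smul_eq_iff] at this

/-- The fixed spaces of mutually normalizing subgroups of coprime order are independent as soon as
they are so in pairs. -/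
theorem eq_zero_of_sum_fixedVectors_eq_zero (s : Finset (Subgroup H)) (w : Subgroup H → V)
    (hw : ∀ B ∈ s, w B ∈ fixedVectors V B)
    (hs : ∀ B ∈ s, ∀ B' ∈ s, B ≠ B' → ∀ b ∈ B, ∀ b' ∈ B', b⁻¹ * b' * b ∈ B')
    (hs' : ∀ B ∈ s, ∀ B' ∈ s, B ≠ B' → ∀ v ∈ fixedVectors V B, v ∈ fixedVectors V B' → v = 0)
    (hc : ∀ v : V, Nat.card H • v = 0 → v = 0) (hsum : ∑ B ∈ s, w B = 0) :
    ∀ B ∈ s, w B = 0 := by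
  intro B hB
  -- The norm of `B` multiplies `w B` by |B|. It kills every other `w B'`, since the image is fixed
  -- by `B` and, as `B` normalizes `B'`, also by `B'`.
  have h1 := congrArg (subgroupSum V B) hsum
  rw [map_sum, map_zero, Finset.sum_eq_single_of_mem B hB, subgroupSum_of_mem (hw B hB)] at h1
  · exact card_nsmul_injective_of_dvd (Subgroup.card_subgroup_dvd_card B) hc _ h1
  · intro B' hB' hne
    exact hs' B hB B' hB' hne.symm _ (subgroupSum_mem _ _)
      (subgroupSum_mem_of_normalizing (hs B hB B' hB' hne.symm) (hw B' hB'))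

end NormSums

/-! ### Regular orbits of groups of class two -/

section RegularOrbit

open scoped commutatorElement Pointwise

variable {H V : Type*} [Group H] [AddCommGroup V] [DistribMulAction H V] [Finite H]

/-- A finite group of odd order and class at most two, acting coprimely with fixed point free
centre, has a regular orbit. -/
theorem exists_trivial_stabilizer_of_class_two [Nontrivial V] (hodd : Odd (Nat.card H))
    (hclass : ∀ a b : H, ⁅a, b⁆ ∈ Subgroup.center H)
    (hfree : ∀ z ∈ Subgroup.center H, z ≠ 1 → ∀ v : V, z • v = v → v = 0)
    (hc : ∀ v : V, Nat.card H • v = 0 → v = 0) : ∃ v : V, ∀ g : H, g • v = v → g = 1 := by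
  classical
  -- `B` is maximal among the stabilizers of nonzero vectors, so distinct conjugates of `B` have
  -- fixed spaces that meet in zero. It also meets the centre trivially.
  obtain ⟨B, ⟨v₀, hv₀, rfl⟩, hmax⟩ := (Set.toFinite
    {B : Subgroup H | ∃ v : V, v ≠ 0 ∧ B = MulAction.stabilizer H v}).exists_maximal
    (by obtain ⟨v, hv⟩ := exists_ne (0 : V); exact ⟨_, v, hv, rfl⟩)
  set B := MulAction.stabilizer H v₀ with hBdef
  have hst : ∀ (g : H) (v : V),
      MulAction.stabilizer H (g • v) = MulAut.conj g • MulAction.stabilizer H v :=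
    fun g v => MulAction.stabilizer_smul_eq_stabilizer_map_conj g v
  have hmaxB : ∀ v : V, v ≠ 0 → B ≤ MulAction.stabilizer H v → MulAction.stabilizer H v = B :=
    fun v hv hle => le_antisymm (hmax ⟨v, hv, rfl⟩ hle) hle
  have hmaxc : ∀ (g : H) (v : V), v ≠ 0 → v ∈ fixedVectors V (MulAut.conj g • B) →
      MulAction.stabilizer H v = MulAut.conj g • B := by
    intro g v hv hle
    have h1 := hmaxB (g⁻¹ • v) (by simpa [smul_eq_zero_iff_eq] using hv) (by
      intro b hb
      have h2 := hle (g * b * g⁻¹) (by rw [mem_conj_smul_iff]; simpa [mul_assoc] using hb)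
      rw [MulAction.mem_stabilizer_iff, smul_smul, ← smul_eq_iff_eq_inv_smul, smul_smul, ← mul_assoc]
      exact h2)
    rw [← h1, ← hst, smul_inv_smul]
  -- An element that maps a point of `B` into `B` commutes with it.
  have hN : ∀ b ∈ B, ∀ g : H, g * b * g⁻¹ ∈ B → Commute g b := by
    intro b hb g hg
    have h1 : ⁅g, b⁆ ∈ B := by
      rw [commutatorElement_def]; exact mul_mem hg (inv_mem hb)
    by_contra hne
    exact hv₀ (hfree _ (hclass g b) (fun h => hne (commutatorElement_eq_one_iff_commute.1 h)) _ h1)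
  have hBcomm : ∀ b ∈ B, ∀ b' ∈ B, Commute b b' := fun b hb b' hb' =>
    hN b' hb' b (mul_mem (mul_mem hb hb') (inv_mem hb))
  have hcent : ∀ c ∈ Subgroup.center H, ∀ x, Commute c x := fun c hc x =>
    (Subgroup.mem_center_iff.1 hc x).symm
  have hshift : ∀ g x : H, g⁻¹ * x * g = ⁅g⁻¹, x⁆ * x := by
    intro g x; rw [commutatorElement_def]; group
  have hshift' : ∀ e g x : H, Commute e (g⁻¹ * x * g) → Commute e x := by
    intro e g x h
    rw [hshift] at h
    have h1 := ((hcent _ (hclass g⁻¹ x) e).symm.inv_right).mul_right h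
    rwa [inv_mul_cancel_left] at h1
  by_cases hB : B = ⊥
  · refine ⟨v₀, fun g hg => ?_⟩
    have : g ∈ B := hg
    rwa [hB, Subgroup.mem_bot] at this
  obtain ⟨⟨b, hb⟩, hb1⟩ := (Subgroup.ne_bot_iff_exists_ne_one).1 hB
  replace hb1 : b ≠ 1 := fun h => hb1 (Subtype.ext h)
  have hmoves : ∀ x ∈ B, ∀ g : H, ¬ Commute g x → MulAut.conj g • B ≠ B := by
    intro x hx g hg h
    refine hg (hN x hx g ?_)
    rw [← h, mem_conj_smul_iff]
    simpa [mul_assoc] using hx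
  have hcommconj : ∀ e : H, (∀ b ∈ B, Commute e b) → ∀ g : H, ∀ x ∈ MulAut.conj g • B,
      Commute e x := fun e he g x hx => hshift' e g x (he _ (mem_conj_smul_iff.1 hx))
  let _ : Fintype H := Fintype.ofFinite H
  let s : Finset (Subgroup H) := Finset.univ.image fun g : H => MulAut.conj g • B
  have hs : ∀ {C : Subgroup H}, C ∈ s ↔ ∃ g : H, MulAut.conj g • B = C := by simp [s]
  have hγ : ∀ C : Subgroup H, ∃ g : H, C ∈ s → MulAut.conj g • B = C := by
    intro C
    by_cases hC : C ∈ s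
    · exact (hs.1 hC).imp fun g hg _ => hg
    · exact ⟨1, fun h => absurd h hC⟩
  choose γ hγ using hγ
  have hstw : ∀ C ∈ s, MulAction.stabilizer H (γ C • v₀) = C := fun C hC => by
    rw [hst, hγ C hC]
  have hwne : ∀ C : Subgroup H, γ C • v₀ ≠ 0 := fun C => by
    simpa [smul_eq_zero_iff_eq] using hv₀
  have hsconj : ∀ g : H, ∀ C ∈ s, MulAut.conj g • C ∈ s := by
    intro g C hC
    obtain ⟨h, rfl⟩ := hs.1 hC
    exact hs.2 ⟨g * h, by rw [map_mul, mul_smul]⟩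
  have hBs : B ∈ s := hs.2 ⟨1, by simp⟩
  have hcomms : ∀ C ∈ s, ∀ C' ∈ s, ∀ c ∈ C, ∀ c' ∈ C', Commute c c' := by
    intro C hC C' hC' c hc c' hc'
    obtain ⟨g, rfl⟩ := hs.1 hC
    obtain ⟨h, rfl⟩ := hs.1 hC'
    exact hcommconj c (fun b hb => (hcommconj b (hBcomm b hb) g c hc).symm) h c' hc'
  -- One vector with stabilizer `C` for each conjugate `C` of `B` except `B` itself. The omission
  -- forces an element that fixes the sum to normalize `B`.
  refine ⟨∑ C ∈ s.erase B, γ C • v₀, fun e he => ?_⟩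
  -- The term at `D` is the component of `e • v - v` in the fixed space of `D`, where `v` is the
  -- chosen sum.
  have hzero := eq_zero_of_sum_fixedVectors_eq_zero s
    (fun D => (∑ C ∈ (s.erase B) with MulAut.conj e • C = D, e • γ C • v₀) -
      if D ∈ s.erase B then γ D • v₀ else 0) ?_ ?_ ?_ hc ?_
  rotate_left
  · intro D hD
    refine sub_mem (sum_mem fun C hC => ?_) ?_
    · rw [Finset.mem_filter] at hC
      rw [← hC.2]
      exact smul_mem_fixedVectors_conj (hstw C (Finset.mem_of_mem_erase hC.1)).ge e
    · split_ifs with h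
      · exact (hstw D hD).ge
      · exact zero_mem _
  · intro C hC C' hC' _ c hc c' hc'
    rwa [(hcomms C hC C' hC' c hc c' hc').inv_left.eq, inv_mul_cancel_right]
  · intro C hC C' hC' hne v hv hv'
    by_contra hv0
    obtain ⟨g, rfl⟩ := hs.1 hC
    obtain ⟨h, rfl⟩ := hs.1 hC'
    exact hne ((hmaxc g v hv0 hv).symm.trans (hmaxc h v hv0 hv'))
  · have h1 := Finset.sum_fiberwise_of_maps_to (s := s.erase B) (t := s)
      (g := fun C => MulAut.conj e • C) (fun C hC => hsconj e C (Finset.mem_of_mem_erase hC))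
      (fun C => e • γ C • v₀)
    have h2 : (∑ D ∈ s, if D ∈ s.erase B then γ D • v₀ else 0) = ∑ C ∈ s.erase B, γ C • v₀ := by
      rw [← Finset.sum_filter]
      congr 1
      ext C
      simp
    rw [Finset.sum_sub_distrib, h2, sub_eq_zero]
    exact h1.trans ((Finset.smul_sum).symm.trans he)
  -- If `e` moved another conjugate onto `B`, then `e • v` would have a nonzero component at `B`,
  -- and `v` has none.
  have heB : ∀ b ∈ B, Commute e b := by
    by_cases hBe : MulAut.conj e⁻¹ • B = B
    · intro b hb
      have h1 := hb
      rw [← hBe, mem_conj_smul_iff, inv_inv] at h1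
      exact hN b hb e h1
    · have h1 := hzero B hBs
      rw [Finset.sum_eq_single_of_mem (MulAut.conj e⁻¹ • B)] at h1
      · simp only [Finset.mem_erase, ne_eq, not_true_eq_false, false_and, if_false, sub_zero] at h1
        exact absurd ((smul_eq_zero_iff_eq _).1 h1) (hwne _)
      · simp only [Finset.mem_filter, Finset.mem_erase]
        exact ⟨⟨hBe, hsconj _ _ hBs⟩, by rw [map_inv, smul_inv_smul]⟩
      · intro C hC hne
        refine absurd ?_ hne
        rw [← (Finset.mem_filter.1 hC).2, map_inv, inv_smul_smul]
  -- Now `e` normalizes every conjugate of `B`, so it fixes each summand separately.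
  have hemem : ∀ C ∈ s.erase B, e ∈ C := by
    intro C hC
    have hCs := Finset.mem_of_mem_erase hC
    have hconj : ∀ C' ∈ s, MulAut.conj e • C' = C' := by
      intro C' hC'
      obtain ⟨g, rfl⟩ := hs.1 hC'
      ext x
      rw [mem_conj_smul_iff]
      constructor
      · intro hx
        have h1 := (hcommconj e heB g _ hx).eq
        simp only [← mul_assoc, mul_inv_cancel, one_mul] at h1
        rwa [← mul_right_cancel h1] at hx
      · intro hx
        rwa [mul_assoc, ← (hcommconj e heB g x hx).eq, inv_mul_cancel_left]
    have h1 := hzero C hCs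
    rw [Finset.sum_eq_single_of_mem C, if_pos hC, sub_eq_zero] at h1
    · have h2 : e ∈ MulAction.stabilizer H (γ C • v₀) := h1
      rwa [hstw C hCs] at h2
    · exact Finset.mem_filter.2 ⟨hC, hconj C hCs⟩
    · intro C' hC' hne
      have h2 := Finset.mem_filter.1 hC'
      exact absurd ((hconj C' (Finset.mem_of_mem_erase h2.1)).symm.trans h2.2) hne
  have hmem : ∀ g : H, MulAut.conj g • B ≠ B → e ∈ MulAut.conj g • B := fun g hg =>
    hemem _ (Finset.mem_erase.2 ⟨hg, hs.2 ⟨g, rfl⟩⟩)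
  by_contra he1
  have hncen : ∀ x ∈ B, x ≠ 1 → ∃ g : H, ¬ Commute g x := by
    intro x hx hx1
    by_contra! h
    exact hv₀ (hfree x (Subgroup.mem_center_iff.2 fun g => (h g).eq) hx1 v₀ hx)
  obtain ⟨g, hg⟩ := hncen b hb hb1
  have heg := mem_conj_smul_iff.1 (hmem g (hmoves b hb g hg))
  obtain ⟨k, hk⟩ := hncen _ heg (by
    intro h
    rw [mul_assoc, inv_mul_eq_one, right_eq_mul] at h
    exact he1 h)
  -- In odd order `k` is a power of `k ^ 2`, so both move `B` and `e` lies in both conjugates.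
  -- Comparing the two puts the central element `⁅k⁻¹, e⁆` into `B`, so it is trivial, against the
  -- choice of `k`.
  have hk2 : ¬ Commute (k ^ 2) (g⁻¹ * e * g) := by
    intro h
    obtain ⟨j, hj⟩ := hodd
    have h1 : (k ^ 2) ^ (j + 1) = k := by
      rw [← pow_mul, show 2 * (j + 1) = Nat.card H + 1 by omega, pow_succ, pow_card_eq_one',
        one_mul]
    exact hk (h1 ▸ h.pow_left (j + 1))
  have h1 := mem_conj_smul_iff.1 (hmem k (hmoves _ heg k hk))
  have h2 := mem_conj_smul_iff.1 (hmem (k ^ 2) (hmoves _ heg _ hk2))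
  have hc1 := hcent _ (hclass k⁻¹ e)
  have h3 : (k ^ 2)⁻¹ * e * k ^ 2 = ⁅k⁻¹, e⁆ * (k⁻¹ * e * k) := by
    calc (k ^ 2)⁻¹ * e * k ^ 2 = k⁻¹ * (k⁻¹ * e * k) * k := by simp [pow_two, mul_assoc]
      _ = k⁻¹ * ⁅k⁻¹, e⁆ * e * k := by rw [hshift]; group
      _ = ⁅k⁻¹, e⁆ * k⁻¹ * e * k := by rw [(hc1 k⁻¹).eq]
      _ = _ := by group
  rw [h3] at h2
  have h4 : ⁅k⁻¹, e⁆ ∈ B := (Subgroup.mul_mem_cancel_right _ h1).1 h2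
  by_cases h5 : ⁅k⁻¹, e⁆ = 1
  · have h6 : Commute k e := by
      have := (commutatorElement_eq_one_iff_commute.1 h5).inv_left
      rwa [inv_inv] at this
    apply hk
    rw [hshift]
    exact ((hcent _ (hclass _ _) k).symm).mul_right h6
  · exact hv₀ (hfree _ (hclass _ _) h5 v₀ h4)

end RegularOrbit

/-! ### Imprimitivity from an abelian normal subgroup -/

section Imprimitivity

open scoped Pointwise

variable {H V : Type*} [Group H] [AddCommGroup V] [DistribMulAction H V]

theorem card_nsmul_eq_zero_of_isPGroup {p : ℕ} [Fact p.Prime] {Q : Type*} [Group Q] [Finite Q]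
    (hQ : IsPGroup p Q) (hp : ∀ v : V, p • v = 0 → v = 0) (v : V) (hv : Nat.card Q • v = 0) :
    v = 0 := by
  obtain ⟨n, hn⟩ := IsPGroup.iff_card.1 hQ
  rw [hn] at hv
  clear hn
  induction n with
  | zero => simpa using hv
  | succ n ih => exact ih (hp _ (by rwa [smul_smul, ← pow_succ']))

/-- Clifford theory for an abelian normal subgroup: if some nontrivial element of it has a fixed
vector, then a faithful irreducible module is induced from a maximal subgroup `L`. The summand
attached to `L` is the range of `e`, which is `m` times an idempotent. -/
theorem exists_imprimitivity [Finite H]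
    (hirr : ∀ U : AddSubgroup V, (∀ h : H, ∀ u ∈ U, h • u ∈ U) → U = ⊥ ∨ U = ⊤)
    (hfaith : ∀ g : H, (∀ v : V, g • v = v) → g = 1) {A : Subgroup H} [A.Normal]
    (hA : ∀ a ∈ A, ∀ b ∈ A, Commute a b) (hc : ∀ v : V, Nat.card A • v = 0 → v = 0) {a : H}
    (ha : a ∈ A) (ha1 : a ≠ 1) {v : V} (hv : v ≠ 0) (hav : a • v = v) :
    ∃ L : Subgroup H, IsCoatom L ∧ ∃ (e : V →+ V) (m : ℕ), e ≠ 0 ∧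
      (∀ v : V, m • v = 0 → v = 0) ∧ (∀ v, e (e v) = m • e v) ∧
      (∀ l ∈ L, ∀ v, e (l • v) = l • e v) ∧ ∀ g ∉ L, ∀ v, e (g • e v) = 0 := by
  classical
  -- `B` is maximal among the subgroups of `A` with a nonzero fixed vector. Its conjugates also lie
  -- in the abelian group `A`, so their fixed spaces are independent, and `H` permutes them.
  obtain ⟨B, haB, hBmax⟩ := (Set.toFinite {B : Subgroup H | B ≤ A ∧
    ∃ v : V, v ≠ 0 ∧ v ∈ fixedVectors V B}).exists_le_maximal (a := Subgroup.zpowers a)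
    ⟨Subgroup.zpowers_le.2 ha, v, hv, by
      have h1 : Subgroup.zpowers a ≤ MulAction.stabilizer H v := Subgroup.zpowers_le.2 hav
      exact fun b hb => h1 hb⟩
  obtain ⟨⟨hBA, v₀, hv₀, hv₀B⟩, hmax⟩ := hBmax
  have hconjA : ∀ g : H, MulAut.conj g • B ≤ A := fun g x hx => by
    have h1 := ‹A.Normal›.conj_mem _ (hBA (mem_conj_smul_iff.1 hx)) g
    simpa [mul_assoc] using h1
  have hmaxc : ∀ (g : H) (C : Subgroup H), C ≤ A → ∀ u : V, u ≠ 0 → u ∈ fixedVectors V C →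
      MulAut.conj g • B ≤ C → C ≤ MulAut.conj g • B := by
    intro g C hCA u hu huC hBC
    have h1 := hmax (y := MulAut.conj g⁻¹ • C) ⟨?_, g⁻¹ • u, ?_, smul_mem_fixedVectors_conj huC g⁻¹⟩
      ?_
    · intro x hx
      rw [mem_conj_smul_iff]
      apply h1
      rw [mem_conj_smul_iff]
      simpa [mul_assoc] using hx
    · intro x hx
      have h1 := ‹A.Normal›.conj_mem _ (hCA (mem_conj_smul_iff.1 hx)) g⁻¹
      simpa [mul_assoc] using h1
    · simpa [smul_eq_zero_iff_eq] using hu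
    · intro x hx
      rw [mem_conj_smul_iff]
      apply hBC
      rw [mem_conj_smul_iff]
      simpa [mul_assoc] using hx
  have hdisj : ∀ g h : H, MulAut.conj g • B ≠ MulAut.conj h • B → ∀ u : V,
      u ∈ fixedVectors V (MulAut.conj g • B) → u ∈ fixedVectors V (MulAut.conj h • B) → u = 0 := by
    intro g h hne u hug huh
    by_contra hu
    have hsup : u ∈ fixedVectors V (MulAut.conj g • B ⊔ MulAut.conj h • B) := by
      have h1 : MulAut.conj g • B ⊔ MulAut.conj h • B ≤ MulAction.stabilizer H u :=
        sup_le (fun x hx => hug x hx) (fun x hx => huh x hx)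
      exact fun x hx => h1 hx
    have hle : MulAut.conj g • B ⊔ MulAut.conj h • B ≤ A := sup_le (hconjA g) (hconjA h)
    exact hne (le_antisymm (le_sup_left.trans (hmaxc h _ hle u hu hsup le_sup_right))
      (le_sup_right.trans (hmaxc g _ hle u hu hsup le_sup_left)))
  have horth : ∀ g h : H, MulAut.conj g • B ≠ MulAut.conj h • B → ∀ u : V,
      u ∈ fixedVectors V (MulAut.conj h • B) → subgroupSum V (MulAut.conj g • B) u = 0 := by
    intro g h hne u hu
    refine hdisj g h hne _ (subgroupSum_mem _ _) (subgroupSum_mem_of_normalizing ?_ hu)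
    intro b hb b' hb'
    rwa [(hA b (hconjA g hb) b' (hconjA h hb')).inv_left.eq, inv_mul_cancel_right]
  let N : Subgroup H := (MulAction.stabilizer (MulAut H) B).comap MulAut.conj
  have hNmem : ∀ {g : H}, g ∈ N ↔ MulAut.conj g • B = B := Iff.rfl
  -- If `B` were normal, its fixed space would be a nonzero submodule, hence all of `V`, and `a`
  -- would act trivially.
  have hN : N ≠ ⊤ := by
    intro hN
    rcases hirr (fixedVectors V B) fun h u hu => by
      have h1 := smul_mem_fixedVectors_conj hu h
      rwa [hNmem.1 (hN ▸ Subgroup.mem_top h)] at h1 with h | h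
    · exact hv₀ (AddSubgroup.mem_bot.1 (h ▸ hv₀B))
    · refine ha1 (hfaith a fun u => ?_)
      have h1 : u ∈ fixedVectors V B := h ▸ AddSubgroup.mem_top u
      exact h1 a (haB (Subgroup.mem_zpowers a))
  obtain ⟨L, hL, hNL⟩ := (eq_top_or_exists_le_coatom N).resolve_left hN
  let _ : Fintype L := Fintype.ofFinite L
  let D : Finset (Subgroup H) := Finset.univ.image fun l : L => MulAut.conj (l : H) • B
  have hD : ∀ {C : Subgroup H}, C ∈ D ↔ ∃ l ∈ L, MulAut.conj l • B = C := by simp [D]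
  have hBD : B ∈ D := hD.2 ⟨1, one_mem _, by simp⟩
  have hDconj : ∀ l ∈ L, ∀ C ∈ D, MulAut.conj l • C ∈ D := by
    intro l hl C hC
    obtain ⟨k, hk, rfl⟩ := hD.1 hC
    exact hD.2 ⟨l * k, mul_mem hl hk, by rw [map_mul, mul_smul]⟩
  have hcardD : ∀ g : H, Nat.card (MulAut.conj g • B : Subgroup H) = Nat.card B := fun g =>
    (Nat.card_congr (Subgroup.equivSMul (MulAut.conj g) B).toEquiv).symm
  -- On the sum of the fixed spaces of the `L`-conjugates of `B` this is multiplication by |B|, and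
  -- it kills the fixed spaces of all other conjugates.
  let e : V →+ V := ∑ C ∈ D, subgroupSum V C
  have he : ∀ u, e u = ∑ C ∈ D, subgroupSum V C u := fun u => by simp [e]
  have hm : ∀ u : V, Nat.card B • u = 0 → u = 0 :=
    card_nsmul_injective_of_dvd (Subgroup.card_dvd_of_le hBA) hc
  have hefix : ∀ C ∈ D, ∀ u ∈ fixedVectors V C, e u = Nat.card B • u := by
    intro C hC u hu
    rw [he, Finset.sum_eq_single_of_mem C hC]
    · rw [subgroupSum_of_mem hu]
      obtain ⟨l, -, rfl⟩ := hD.1 hC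
      rw [hcardD]
    · intro C' hC' hne
      obtain ⟨l, -, rfl⟩ := hD.1 hC
      obtain ⟨l', -, rfl⟩ := hD.1 hC'
      exact horth l' l hne u hu
  refine ⟨L, hL, e, Nat.card B, ?_, hm, ?_, ?_, ?_⟩
  · intro h
    have h1 := hefix B hBD v₀ hv₀B
    rw [h, AddMonoidHom.zero_apply] at h1
    exact hv₀ (hm _ h1.symm)
  · intro u
    rw [he u, map_sum, Finset.smul_sum]
    exact Finset.sum_congr rfl fun C hC => hefix C hC _ (subgroupSum_mem _ _)
  · intro l hl u
    rw [he, he, Finset.smul_sum]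
    refine (Finset.sum_nbij' (fun C => MulAut.conj l • C) (fun C => MulAut.conj l⁻¹ • C)
      (fun C hC => hDconj l hl C hC) (fun C hC => hDconj _ (inv_mem hl) C hC) ?_ ?_ ?_).symm
    · intro C _; rw [map_inv, inv_smul_smul]
    · intro C _; rw [map_inv, smul_inv_smul]
    · intro C _; exact smul_subgroupSum l C u
  · intro g hg u
    rw [he u, Finset.smul_sum, map_sum]
    refine Finset.sum_eq_zero fun C hC => ?_
    rw [he]
    refine Finset.sum_eq_zero fun C' hC' => ?_
    obtain ⟨l, hl, rfl⟩ := hD.1 hC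
    obtain ⟨l', hl', rfl⟩ := hD.1 hC'
    rw [smul_subgroupSum, ← mul_smul, ← map_mul]
    refine horth l' (g * l) (fun h => hg ?_) _ (subgroupSum_mem _ _)
    have h1 : l'⁻¹ * (g * l) ∈ N := by
      rw [hNmem, map_mul, mul_smul, ← h, ← mul_smul, ← map_mul, inv_mul_cancel, map_one, one_smul]
    have h2 := mul_mem (mul_mem hl' (hNL h1)) (inv_mem hl)
    simpa [mul_assoc] using h2

end Imprimitivity

/-! ### The orbit statement for induced modules -/

section Orbits

open scoped Pointwise

/-- Every `p`-element `y` of order `p` of a normal `p`-subgroup of an irreducible group of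
automorphisms of `V` has a vector that no conjugate of `y` fixes. -/
def HasUnfixedVectors (p : ℕ) (V : Type*) [AddCommGroup V] : Prop :=
  ∀ H : Subgroup (AddMonoid.End V)ˣ,
    (∀ U : AddSubgroup V, (∀ h : H, ∀ u ∈ U, h • u ∈ U) → U = ⊥ ∨ U = ⊤) →
    ∀ P : Subgroup H, P.Normal → IsPGroup p P → ∀ y ∈ P, y ^ p = 1 → y ≠ 1 →
      ∃ v : V, ∀ h : H, (h * y * h⁻¹) • v ≠ v

variable {H V : Type*} [Group H] [AddCommGroup V] [DistribMulAction H V]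

/-- Passing to the image in the automorphism group of `V` covers actions that need not be faithful,
such as that of a block stabilizer on its block. -/
theorem HasUnfixedVectors.exists_forall_conj_smul_ne {p : ℕ} (hV : HasUnfixedVectors p V)
    (hirr : ∀ U : AddSubgroup V, (∀ h : H, ∀ u ∈ U, h • u ∈ U) → U = ⊥ ∨ U = ⊤)
    {P : Subgroup H} [P.Normal] (hP : IsPGroup p P) {y : H} (hy : y ∈ P) (hyp : y ^ p = 1)
    (hyV : ∃ v : V, y • v ≠ v) : ∃ v : V, ∀ h : H, (h * y * h⁻¹) • v ≠ v := by
  let f : H →* (AddMonoid.End V)ˣ := (DistribMulAction.toAddMonoidEnd H V).toHomUnits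
  have hf : ∀ (h : H) (v : V), f.rangeRestrict h • v = h • v := fun h v => rfl
  obtain ⟨v, hv⟩ := hV f.range (fun U hU => hirr U fun h u hu => hU (f.rangeRestrict h) u hu)
    (P.map f.rangeRestrict) (Subgroup.Normal.map inferInstance _ f.rangeRestrict_surjective)
    (hP.map _) (f.rangeRestrict y) (Subgroup.mem_map_of_mem _ hy)
    (by rw [← map_pow, hyp, map_one]) (fun h => by
      obtain ⟨v, hv⟩ := hyV
      exact hv (by rw [← hf, h, one_smul]))
  refine ⟨v, fun h => ?_⟩
  have := hv (f.rangeRestrict h)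
  rwa [← map_inv, ← map_mul, ← map_mul, hf] at this

/-- The orbit statement for a module induced from `W`, given the one for `W`. -/
theorem exists_forall_conj_smul_ne_of_imprimitive [Finite H] {p : ℕ}
    (hirr : ∀ U : AddSubgroup V, (∀ h : H, ∀ u ∈ U, h • u ∈ U) → U = ⊥ ∨ U = ⊤)
    (hfaith : ∀ g : H, (∀ v : V, g • v = v) → g = 1)
    (ih : ∀ W : AddSubgroup V, W ≠ ⊤ → HasUnfixedVectors p W)
    {P : Subgroup H} [P.Normal] (hP : IsPGroup p P) (hnil : Group.IsNilpotent P)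
    {y : H} (hy : y ∈ P) (hyp : y ^ p = 1) (hy1 : y ≠ 1)
    {L : Subgroup H} (hL : IsCoatom L) {e : V →+ V} {m : ℕ} (he0 : e ≠ 0)
    (hm : ∀ v : V, m • v = 0 → v = 0) (hee : ∀ v, e (e v) = m • e v)
    (hel : ∀ l ∈ L, ∀ v, e (l • v) = l • e v) (heg : ∀ g ∉ L, ∀ v, e (g • e v) = 0) :
    ∃ v : V, ∀ h : H, (h * y * h⁻¹) • v ≠ v := by
  have hblock : ∀ w : V, w ≠ 0 → w ∈ e.range → ∀ g : H, g • w ∈ e.range → g ∈ L := by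
    rintro w hw ⟨u, rfl⟩ g ⟨u', hu'⟩
    by_contra hg
    have h1 := heg g hg u
    rw [← hu', hee] at h1
    rw [hm _ h1, eq_comm, smul_eq_zero_iff_eq] at hu'
    exact hw hu'
  obtain ⟨w₀, hw₀, hw₀e⟩ : ∃ w : V, w ≠ 0 ∧ w ∈ e.range := by
    by_contra! h
    exact he0 (AddMonoidHom.ext fun v => by
      by_contra hv
      exact h (e v) hv ⟨v, rfl⟩)
  -- If `P` is not inside `L`, then normalizers grow in the nilpotent group `P`, so the normalizer
  -- of `P ⊓ L` properly contains the maximal subgroup `L`.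
  have hnormal : ∀ g : H, ∀ x ∈ P ⊓ L, g * x * g⁻¹ ∈ P ⊓ L := by
    by_cases hPL : P ≤ L
    · intro g x hx
      rw [inf_eq_left.2 hPL] at hx ⊢
      exact ‹P.Normal›.conj_mem x hx g
    · have hPLn : (P ⊓ L).subgroupOf P ≠ ⊤ := by
        rw [Ne, Subgroup.subgroupOf_eq_top]
        exact fun h => hPL (h.trans inf_le_right)
      have h1 := Group.normalizerCondition_of_isNilpotent (G := P) _ (lt_top_iff_ne_top.2 hPLn)
      obtain ⟨g, hg, hgn⟩ := SetLike.exists_of_lt h1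
      have hgL : (g : H) ∉ L := fun h => hgn (Subgroup.mem_subgroupOf.2 ⟨g.2, h⟩)
      have hgN : (g : H) ∈ Subgroup.normalizer ((P ⊓ L : Subgroup H) : Set H) := by
        rw [Subgroup.mem_normalizer_iff]
        intro x
        rw [Subgroup.mem_normalizer_iff] at hg
        constructor
        · intro hx
          exact Subgroup.mem_subgroupOf.1 ((hg ⟨x, hx.1⟩).1 (Subgroup.mem_subgroupOf.2 hx))
        · intro hx
          have hxP : x ∈ P := by
            have := ‹P.Normal›.conj_mem _ hx.1 (g : H)⁻¹
            simpa [mul_assoc] using this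
          exact Subgroup.mem_subgroupOf.1 ((hg ⟨x, hxP⟩).2 (Subgroup.mem_subgroupOf.2 hx))
      have hLN : L ≤ Subgroup.normalizer ((P ⊓ L : Subgroup H) : Set H) := by
        intro l hl
        rw [Subgroup.mem_normalizer_iff]
        intro x
        constructor
        · intro hx
          exact ⟨‹P.Normal›.conj_mem x hx.1 l, L.mul_mem (L.mul_mem hl hx.2) (L.inv_mem hl)⟩
        · intro hx
          have h3 := ‹P.Normal›.conj_mem _ hx.1 l⁻¹
          have h4 := L.mul_mem (L.mul_mem (L.inv_mem hl) hx.2) hl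
          exact ⟨by simpa [mul_assoc] using h3, by simpa [mul_assoc] using h4⟩
      have htop : Subgroup.normalizer ((P ⊓ L : Subgroup H) : Set H) = ⊤ :=
        hL.2 _ (lt_of_le_of_ne hLN fun h => hgL (h ▸ hgN))
      intro g x hx
      have : g ∈ Subgroup.normalizer ((P ⊓ L : Subgroup H) : Set H) := htop ▸ Subgroup.mem_top g
      exact (Subgroup.mem_normalizer_iff.1 this x).1 hx
  by_cases hyL : y ∈ L
  swap
  -- By normality of `P ⊓ L` no conjugate of `y` is in `L`, so each moves the block of `w₀` off
  -- itself.
  · refine ⟨w₀, fun h hfix => hyL ?_⟩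
    have h1 := hblock w₀ hw₀ hw₀e (h * y * h⁻¹) (by rwa [hfix])
    have h2 := hnormal h⁻¹ _ ⟨‹P.Normal›.conj_mem y hy h, h1⟩
    have h3 : h⁻¹ * (h * y * h⁻¹) * h⁻¹⁻¹ = y := by group
    rw [h3] at h2
    exact h2.2
  have hgen : ∀ U : AddSubgroup V, (∀ h : H, ∀ u ∈ U, h • u ∈ U) → e.range ≤ U → U = ⊤ := by
    intro U hU hle
    refine (hirr U hU).resolve_left fun h => hw₀ ?_
    rw [← AddSubgroup.mem_bot, ← h]
    exact hle hw₀e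
  -- Some conjugate of `y` acts nontrivially on the range of `e`.
  obtain ⟨k, w₁, hw₁, hk⟩ : ∃ k : H, ∃ w ∈ e.range, (k⁻¹ * y * k) • w ≠ w := by
    by_contra! h
    refine hy1 (hfaith y fun v => ?_)
    let U : AddSubgroup V := fixedVectors V (Subgroup.normalClosure {y})
    have hU : U = ⊤ := by
      refine hgen U (fun h u hu x hx => ?_) fun w hw x hx => ?_
      · have h1 := hu _ (Subgroup.normalClosure_normal.conj_mem x hx h⁻¹)
        rw [inv_inv, ← smul_smul, ← smul_smul, inv_smul_eq_iff] at h1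
        exact h1
      · have h1 : Subgroup.normalClosure {y} ≤ MulAction.stabilizer H w := by
          refine (Subgroup.closure_le _).2 fun z hz => ?_
          obtain ⟨a, ha, hza⟩ := Group.mem_conjugatesOfSet_iff.1 hz
          obtain rfl := Set.mem_singleton_iff.1 ha
          obtain ⟨c, rfl⟩ := isConj_iff.1 hza
          have := h c⁻¹ w hw
          rwa [inv_inv] at this
        exact h1 hx
    have h1 : v ∈ U := hU ▸ AddSubgroup.mem_top v
    exact h1 y (Subgroup.subset_normalClosure rfl)
  have hy'PL : k⁻¹ * y * k ∈ P ⊓ L := by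
    have := hnormal k⁻¹ y ⟨hy, hyL⟩
    rwa [inv_inv] at this
  set y' := k⁻¹ * y * k with hy'
  let W : AddSubgroup V := e.range
  have hLW : ∀ l ∈ L, ∀ w ∈ W, l • w ∈ W := by
    rintro l hl _ ⟨u, rfl⟩
    exact ⟨l • u, hel l hl u⟩
  let _ : DistribMulAction L W :=
    { smul := fun l w => ⟨(l : H) • (w : V), hLW l l.2 w w.2⟩
      one_smul := fun w => Subtype.ext (one_smul H (w : V))
      mul_smul := fun a b w => Subtype.ext (mul_smul (a : H) (b : H) (w : V))
      smul_zero := fun a => Subtype.ext (smul_zero (a : H))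
      smul_add := fun a v w => Subtype.ext (smul_add (a : H) (v : V) (w : V)) }
  have hcoe : ∀ (l : L) (w : W), ((l • w : W) : V) = (l : H) • (w : V) := fun _ _ => rfl
  have hWtop : W ≠ ⊤ := by
    intro h
    refine hL.1 (eq_top_iff.2 fun g _ => hblock w₀ hw₀ hw₀e g ?_)
    change g • w₀ ∈ W
    rw [h]
    exact AddSubgroup.mem_top _
  have hWirr : ∀ U : AddSubgroup W, (∀ l : L, ∀ u ∈ U, l • u ∈ U) → U = ⊥ ∨ U = ⊤ := by
    intro U hU
    by_contra! hne
    obtain ⟨u₀, hu₀⟩ := (AddSubgroup.ne_bot_iff_exists_ne_zero).1 hne.1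
    apply hne.2
    -- The `H`-translates of `U` span `V`, while `e` maps the span into `U`: translates by `L` stay
    -- in `U`, and all others are killed. So the range of `e` is inside `U`.
    let S : Set V := {x | ∃ h : H, ∃ u ∈ U, h • (u : V) = x}
    have hS : AddSubgroup.closure S = ⊤ := by
      refine (hirr _ fun h u hu => ?_).resolve_left fun h => hu₀ ?_
      · induction hu using AddSubgroup.closure_induction with
        | mem x hx =>
          obtain ⟨g, u, hu, rfl⟩ := hx
          exact AddSubgroup.subset_closure ⟨h * g, u, hu, mul_smul _ _ _⟩
        | zero => rw [smul_zero]; exact zero_mem _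
        | add a b _ _ ha hb => rw [smul_add]; exact add_mem ha hb
        | neg a _ ha => rw [smul_neg]; exact neg_mem ha
      · have h1 : ((u₀ : W) : V) ∈ AddSubgroup.closure S :=
          AddSubgroup.subset_closure ⟨1, u₀, u₀.2, one_smul _ _⟩
        rw [h, AddSubgroup.mem_bot] at h1
        exact Subtype.ext (Subtype.ext h1)
    have hmem : ∀ x ∈ AddSubgroup.closure S, e x ∈ U.map W.subtype := by
      intro x hx
      induction hx using AddSubgroup.closure_induction with
      | mem x hx =>
        obtain ⟨g, u, hu, rfl⟩ := hx
        obtain ⟨u', hu'⟩ := u.2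
        rw [← hu']
        by_cases hg : g ∈ L
        · rw [hel g hg, hee, hu']
          have h1 := hU ⟨g, hg⟩ _ (nsmul_mem hu m)
          exact ⟨_, h1, rfl⟩
        · rw [heg g hg]
          exact zero_mem _
      | zero => rw [map_zero]; exact zero_mem _
      | add a b _ _ ha hb => rw [map_add]; exact add_mem ha hb
      | neg a _ ha => rw [map_neg]; exact neg_mem ha
    rw [eq_top_iff]
    rintro ⟨_, u, rfl⟩ -
    obtain ⟨w, hw, hwu⟩ := hmem u (hS ▸ AddSubgroup.mem_top u)
    have : w = ⟨e u, u, rfl⟩ := Subtype.ext hwu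
    rwa [← this]
  have hPL : IsPGroup p (P.subgroupOf L) := hP.comap_of_injective L.subtype L.subtype_injective
  have hy'p : y' ^ p = 1 := by
    have h1 : y' ^ p = k⁻¹ * y ^ p * k := by
      have := conj_pow (i := p) (a := k⁻¹) (b := y)
      rwa [inv_inv] at this
    rw [h1, hyp, mul_one, inv_mul_cancel]
  obtain ⟨w, hw⟩ := (ih W hWtop).exists_forall_conj_smul_ne hWirr hPL
    (y := ⟨y', hy'PL.2⟩) (Subgroup.mem_subgroupOf.2 hy'PL.1) (Subtype.ext hy'p)
    ⟨⟨w₁, hw₁⟩, fun h => hk (congrArg Subtype.val h)⟩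
  obtain ⟨x, hx⟩ := w.2
  let _ : Fintype (H ⧸ L) := Fintype.ofFinite _
  -- For every `g`, applying `e` to the translate of this sum by `g⁻¹` leaves `m` times an
  -- `L`-translate of `w`. A conjugate of `y` fixing the sum would therefore give an `L`-conjugate
  -- of `y'` fixing `w`.
  refine ⟨∑ c : H ⧸ L, c.out • (w : V), fun h hfix => ?_⟩
  set v : V := ∑ c : H ⧸ L, c.out • (w : V) with hv
  have hy'' : h * y * h⁻¹ = (h * k) * y' * (h * k)⁻¹ := by rw [hy']; group
  rw [hy'', ← smul_smul, ← smul_smul, smul_eq_iff_eq_inv_smul] at hfix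
  have h1 := congrArg e hfix
  rw [hel y' hy'PL.2] at h1
  set g := h * k
  have hl : g⁻¹ * (QuotientGroup.mk g : H ⧸ L).out ∈ L :=
    QuotientGroup.eq.1 (Quotient.out_eq' (QuotientGroup.mk g : H ⧸ L)).symm
  have h2 : e (g⁻¹ • v) = m • (g⁻¹ * (QuotientGroup.mk g : H ⧸ L).out) • (w : V) := by
    rw [hv, Finset.smul_sum, map_sum, Finset.sum_eq_single (QuotientGroup.mk g : H ⧸ L)]
    · rw [smul_smul, hel _ hl, ← hx, hee, smul_comm]
    · intro c _ hc
      rw [smul_smul, ← hx]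
      refine heg _ (fun hmem => hc ?_) x
      rw [← Quotient.out_eq' c]
      exact (QuotientGroup.eq.2 hmem).symm
    · intro h; exact absurd (Finset.mem_univ _) h
  rw [h2, smul_comm] at h1
  set l := g⁻¹ * (QuotientGroup.mk g : H ⧸ L).out
  have h3 : y' • l • (w : V) = l • (w : V) := by
    rw [← sub_eq_zero]
    exact hm _ (by rw [smul_sub, h1, sub_self])
  refine hw ⟨l, hl⟩⁻¹ (Subtype.ext ?_)
  rw [hcoe]
  simp only [Subgroup.coe_mul, Subgroup.coe_inv, inv_inv]
  rw [← smul_smul, ← smul_smul, h3, inv_smul_smul]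

end Orbits

/-! ### The orbit theorem -/

section OrbitTheorem

open scoped commutatorElement

variable {H V : Type*} [Group H] [AddCommGroup V] [DistribMulAction H V]

/-- If `p` divided |V|, the `p`-group `P` would fix a nonzero vector. Its fixed vectors form a
submodule because `P` is normal, so `P` would act trivially. -/
theorem nsmul_eq_zero_of_irreducible [Finite V] {p : ℕ} [Fact p.Prime]
    (hirr : ∀ U : AddSubgroup V, (∀ h : H, ∀ u ∈ U, h • u ∈ U) → U = ⊥ ∨ U = ⊤)
    {P : Subgroup H} [P.Normal] (hP : IsPGroup p P) {y : H} (hy : y ∈ P) (hyV : ∃ v : V, y • v ≠ v)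
    (v : V) (hv : p • v = 0) : v = 0 := by
  have hdvd : ¬ p ∣ Nat.card V := by
    intro h
    obtain ⟨b, hb, hb0⟩ := hP.exists_fixed_point_of_prime_dvd_card_of_fixed_point V h (a := 0)
      (fun g => smul_zero g)
    rcases hirr (fixedVectors V P) fun h u hu x hx => by
      have h1 := hu _ (‹P.Normal›.conj_mem x hx h⁻¹)
      rw [inv_inv, ← smul_smul, ← smul_smul, inv_smul_eq_iff] at h1
      exact h1 with h | h
    · have h1 : b ∈ fixedVectors V P := fun x hx => hb ⟨x, hx⟩
      rw [h, AddSubgroup.mem_bot] at h1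
      exact hb0 h1.symm
    · obtain ⟨v, hv⟩ := hyV
      have h1 : v ∈ fixedVectors V P := h ▸ AddSubgroup.mem_top v
      exact hv (h1 y hy)
  have h1 : addOrderOf v ∣ p := addOrderOf_dvd_of_nsmul_eq_zero hv
  have h2 : addOrderOf v ∣ Nat.card V := addOrderOf_dvd_natCard v
  rcases (Nat.dvd_prime Fact.out).1 h1 with h | h
  · exact AddMonoid.addOrderOf_eq_one_iff.1 h
  · exact absurd (h ▸ h2) hdvd

/-- The orbit statement when all abelian normal subgroups inside `P` act fixed point freely. -/
theorem exists_forall_conj_smul_ne_of_primitive [Finite H] [Nontrivial V] {p : ℕ} [Fact p.Prime]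
    (hp : Odd p) {P : Subgroup H} [P.Normal] (hP : IsPGroup p P)
    (hc : ∀ v : V, p • v = 0 → v = 0)
    (hfree : ∀ A : Subgroup H, A.Normal → A ≤ P → (∀ a ∈ A, ∀ b ∈ A, Commute a b) →
      ∀ a ∈ A, a ≠ 1 → ∀ v : V, a • v = v → v = 0)
    {y : H} (hy : y ∈ P) (hyp : y ^ p = 1) (hy1 : y ≠ 1) :
    ∃ v : V, ∀ h : H, (h * y * h⁻¹) • v ≠ v := by
  have hPn : Nontrivial P := ⟨⟨y, hy⟩, 1, fun h => hy1 (congrArg Subtype.val h)⟩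
  have hcn : Nontrivial (Subgroup.center P) := hP.center_nontrivial
  have hdvd : p ∣ Nat.card (Subgroup.center P) :=
    (hP.to_subgroup _).card_eq_or_dvd.resolve_left fun h =>
      not_nontrivial_iff_subsingleton.2 (Nat.card_eq_one_iff_unique.1 h).1 hcn
  obtain ⟨⟨z, hz⟩, hzp⟩ := exists_prime_orderOf_dvd_card' p hdvd
  rw [Subgroup.orderOf_mk] at hzp
  have hz1 : z ≠ 1 := by
    rintro rfl
    rw [orderOf_one] at hzp
    exact (Fact.out : p.Prime).one_lt.ne hzp
  replace hzp : z ^ p = 1 := hzp ▸ pow_orderOf_eq_one z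
  set Ω := omegaSecondCenter P p hp with hΩdef
  have hzΩ : z ∈ Ω := ⟨hzp, fun g => by
    rw [commutatorElement_eq_one_iff_mul_comm.2 (Subgroup.mem_center_iff.1 hz g).symm]
    exact one_mem _⟩
  let E : Subgroup H := Ω.map P.subtype
  have hE : E.Normal := ConjAct.normal_of_characteristic_of_normal
  -- `A` is the centre of `Ω` viewed in `H`. It is an abelian normal subgroup inside `P`, so it acts
  -- fixed point freely.
  let A : Subgroup H := E ⊓ Subgroup.centralizer (E : Set H)
  have hAn : A.Normal := Subgroup.normal_inf_normal _ _
  have hAP : A ≤ P := inf_le_left.trans (Subgroup.map_subtype_le _)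
  have hAcomm : ∀ a ∈ A, ∀ b ∈ A, Commute a b := fun a ha b hb =>
    (Subgroup.mem_centralizer_iff.1 ha.2 b hb.1).symm
  have hmemA : ∀ u ∈ Ω, (∀ w ∈ Ω, Commute u w) → (u : H) ∈ A := by
    intro u hu h
    refine ⟨Subgroup.mem_map_of_mem P.subtype hu, Subgroup.mem_centralizer_iff.2 ?_⟩
    rintro _ ⟨w, hw, rfl⟩
    exact congrArg Subtype.val (h w hw).symm.eq
  have hfreeA := hfree A hAn hAP hAcomm
  have hΩ : ∀ u ∈ Ω, (∀ w ∈ Ω, Commute u w) → u ∈ Subgroup.zpowers z := by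
    intro u hu h
    have huA := hmemA u hu h
    have hzA := hmemA z hzΩ fun w _ => (Subgroup.mem_center_iff.1 hz w).symm
    refine mem_zpowers_of_fixedPointFree (V := V) (Subgroup.mem_center_iff.1 hz u) hu.1 hzp hz1 hc ?_
    intro i j hij v hv
    refine hfreeA ((u ^ i * z ^ j : P) : H) ?_ (fun h => hij (Subtype.ext h)) v hv
    rw [Subgroup.coe_mul, Subgroup.coe_pow, Subgroup.coe_pow]
    exact mul_mem (pow_mem huA i) (pow_mem hzA j)
  have hΩp : IsPGroup p Ω := hP.to_subgroup _
  have hodd : Odd (Nat.card Ω) := by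
    obtain ⟨n, hn⟩ := IsPGroup.iff_card.1 hΩp
    rw [hn]
    exact hp.pow
  obtain ⟨v, hv⟩ := exists_trivial_stabilizer_of_class_two (H := Ω) (V := V) hodd
    (fun a b => Subgroup.mem_center_iff.2 fun c =>
      Subtype.ext (Subgroup.mem_center_iff.1 (a.2.2 (b : P)) c))
    (fun u hu hu1 v huv => hfreeA ((u : P) : H)
      (hmemA u u.2 fun w hw =>
        (congrArg Subtype.val (Subgroup.mem_center_iff.1 hu ⟨w, hw⟩)).symm)
      (fun h => hu1 (Subtype.ext (Subtype.ext h))) v huv)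
    (card_nsmul_eq_zero_of_isPGroup hΩp hc)
  refine ⟨v, fun h hfix => hy1 ?_⟩
  -- Every conjugate of `y` is an element of order `p` of `P`, hence lies in `Ω`, where `v` has
  -- trivial stabilizer.
  have hmem : (⟨h * y * h⁻¹, ‹P.Normal›.conj_mem y hy h⟩ : P) ∈ Ω := by
    refine mem_omegaSecondCenter_of_pow_eq_one hp hP hz hzp hz1 hΩ (Subtype.ext ?_)
    change (h * y * h⁻¹) ^ p = 1
    rw [conj_pow, hyp, mul_one, mul_inv_cancel]
  have h1 := hv ⟨_, hmem⟩ hfix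
  have h2 : h * y * h⁻¹ = 1 := congrArg (fun u : Ω => ((u : P) : H)) h1
  exact conj_eq_one_iff.1 h2

theorem hasUnfixedVectors {p : ℕ} [Fact p.Prime] (hp : Odd p) :
    ∀ (n : ℕ) (V : Type*) [AddCommGroup V] [Finite V], Nat.card V = n → HasUnfixedVectors p V := by
  intro n
  induction n using Nat.strong_induction_on with
  | _ n ih =>
    intro V _ _ hn H hirr P hPn hP y hy hyp hy1
    have hfinEnd : Finite (AddMonoid.End V) := DFunLike.finite (V →+ V)
    have hfaith : ∀ g : H, (∀ v : V, g • v = v) → g = 1 := fun g hg =>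
      Subtype.ext (Units.ext (AddMonoidHom.ext hg))
    have hyV : ∃ v : V, y • v ≠ v := by
      by_contra! h
      exact hy1 (hfaith y h)
    have hc := nsmul_eq_zero_of_irreducible hirr hP hy hyV
    have hV : Nontrivial V := by
      obtain ⟨v, hv⟩ := hyV
      exact ⟨_, _, hv⟩
    by_cases hfree : ∀ A : Subgroup H, A.Normal → A ≤ P → (∀ a ∈ A, ∀ b ∈ A, Commute a b) →
        ∀ a ∈ A, a ≠ 1 → ∀ v : V, a • v = v → v = 0
    · exact exists_forall_conj_smul_ne_of_primitive hp hP hc hfree hy hyp hy1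
    push Not at hfree
    obtain ⟨A, hAn, hAP, hA, a, ha, ha1, v, hav, hv⟩ := hfree
    obtain ⟨L, hL, e, m, he0, hm, hee, hel, heg⟩ := exists_imprimitivity hirr hfaith hA
      (card_nsmul_eq_zero_of_isPGroup (hP.to_le hAP) hc) ha ha1 hv hav
    refine exists_forall_conj_smul_ne_of_imprimitive hirr hfaith (fun W hW => ?_) hP hP.isNilpotent
      hy hyp hy1 hL he0 hm hee hel heg
    refine ih (Nat.card W) ?_ W rfl
    rw [← hn]
    exact lt_of_le_of_ne (AddSubgroup.card_le_card_addGroup W)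
      (fun h => hW ((AddSubgroup.card_eq_iff_eq_top W).1 h))

/-- Let a finite group `H` act irreducibly on a finite abelian group `V`, and let `y` be an element
of odd prime order `p` in a normal `p`-subgroup that acts nontrivially. Then some vector is fixed by
no conjugate of `y`. -/
theorem exists_forall_conj_smul_ne [Finite V] {p : ℕ} [Fact p.Prime] (hp : Odd p)
    (hirr : ∀ U : AddSubgroup V, (∀ h : H, ∀ u ∈ U, h • u ∈ U) → U = ⊥ ∨ U = ⊤)
    {P : Subgroup H} [P.Normal] (hP : IsPGroup p P) {y : H} (hy : y ∈ P) (hyp : y ^ p = 1)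
    (hyV : ∃ v : V, y • v ≠ v) : ∃ v : V, ∀ h : H, (h * y * h⁻¹) • v ≠ v :=
  (hasUnfixedVectors hp _ V rfl).exists_forall_conj_smul_ne hirr hP hy hyp hyV

end OrbitTheorem

/-! ### The Fitting subgroup -/

section Fitting

variable {G : Type*} [Group G]

theorem le_fittingSubgroup {N : Subgroup G} (hN : N.Normal) (h : Group.IsNilpotent N) :
    N ≤ fittingSubgroup G :=
  le_sSup ⟨hN, h⟩

variable [Finite G]

/-- Such an `R` is a normal Sylow `p`-subgroup of `K`, and having these for all `p` is nilpotency.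
-/
theorem isNilpotent_of_forall_prime {K : Subgroup G}
    (h : ∀ p : ℕ, p.Prime → ∃ R : Subgroup G, R.Normal ∧ R ≤ K ∧ IsPGroup p R ∧
      ¬ p ∣ R.relIndex K) : Group.IsNilpotent K := by
  refine ((Group.isNilpotent_of_finite_tfae (G := K)).out 0 3 rfl rfl).2 ?_
  intro p hp Q
  obtain ⟨R, hR, hRK, hRp, hRi⟩ := h p hp.out
  let S : Sylow p K := IsPGroup.toSylow (P := R.subgroupOf K)
    (hRp.comap_of_injective K.subtype K.subtype_injective) hRi
  have hS : (S : Subgroup K).Normal := Subgroup.normal_subgroupOf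
  have : Subsingleton (Sylow p K) := (Sylow.unique_of_normal S hS).instSubsingleton
  rwa [Subsingleton.elim Q S]

theorem exists_normal_isPGroup_not_dvd_relIndex {K : Subgroup G} (hK : K.Normal)
    (h : Group.IsNilpotent K) (p : ℕ) (hp : p.Prime) :
    ∃ R : Subgroup G, R.Normal ∧ R ≤ K ∧ IsPGroup p R ∧ ¬ p ∣ R.relIndex K := by
  have : Fact p.Prime := ⟨hp⟩
  let Q : Sylow p K := default
  have hQ : (Q : Subgroup K).Characteristic := Q.characteristic_of_normal inferInstance
  refine ⟨(Q : Subgroup K).map K.subtype, ConjAct.normal_of_characteristic_of_normal,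
    Subgroup.map_subtype_le _, Q.2.map _, ?_⟩
  rw [Subgroup.relIndex, Subgroup.subgroupOf, Subgroup.comap_map_eq_self_of_injective
    K.subtype_injective]
  exact Q.not_dvd_index

/-- Fitting's theorem for finite groups. -/
theorem isNilpotent_sup {N₁ N₂ : Subgroup G} (h₁ : N₁.Normal) (h₂ : N₂.Normal)
    (hn₁ : Group.IsNilpotent N₁) (hn₂ : Group.IsNilpotent N₂) :
    Group.IsNilpotent (N₁ ⊔ N₂ : Subgroup G) := by
  refine isNilpotent_of_forall_prime fun p hp => ?_
  obtain ⟨R₁, hR₁, hle₁, hp₁, hi₁⟩ := exists_normal_isPGroup_not_dvd_relIndex h₁ hn₁ p hp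
  obtain ⟨R₂, hR₂, hle₂, hp₂, hi₂⟩ := exists_normal_isPGroup_not_dvd_relIndex h₂ hn₂ p hp
  refine ⟨R₁ ⊔ R₂, inferInstance, sup_le_sup hle₁ hle₂, hp₁.to_sup_of_normal_right hp₂, ?_⟩
  -- The index of `R₁ ⊔ R₂` factors through `N₁ ⊔ R₂` into divisors of the indices of `R₁` in `N₁`
  -- and `R₂` in `N₂`.
  have e1 : (R₁ ⊔ R₂).relIndex (N₁ ⊔ R₂) = (R₁ ⊔ R₂).relIndex N₁ := by
    have := Subgroup.relIndex_sup_right N₁ (R₁ ⊔ R₂)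
    rwa [← sup_assoc, sup_eq_left.2 hle₁] at this
  have e2 : (N₁ ⊔ R₂).relIndex (N₁ ⊔ N₂) = (N₁ ⊔ R₂).relIndex N₂ := by
    have := Subgroup.relIndex_sup_right N₂ (N₁ ⊔ R₂)
    rwa [sup_comm N₂, sup_assoc, sup_eq_right.2 hle₂] at this
  rw [← Subgroup.relIndex_mul_relIndex (R₁ ⊔ R₂) (N₁ ⊔ R₂) (N₁ ⊔ N₂) (sup_le_sup_right hle₁ _)
    (sup_le_sup_left hle₂ _), e1, e2]
  exact hp.not_dvd_mul (fun h => hi₁ (h.trans (Subgroup.relIndex_dvd_of_le_left _ le_sup_left)))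
    (fun h => hi₂ (h.trans (Subgroup.relIndex_dvd_of_le_left _ le_sup_right)))

theorem fittingSubgroup_isNilpotent : Group.IsNilpotent (fittingSubgroup G) := by
  obtain ⟨N, ⟨hN, hNn⟩, hmax⟩ := (Set.toFinite
    {N : Subgroup G | N.Normal ∧ Group.IsNilpotent N}).exists_maximal
    ⟨⊥, inferInstance, inferInstance⟩
  have h : fittingSubgroup G = N := by
    refine le_antisymm (sSup_le fun K hK => ?_) (le_fittingSubgroup hN hNn)
    exact le_sup_right.trans (hmax (y := N ⊔ K)
      ⟨have := hK.1; inferInstance, isNilpotent_sup hN hK.1 hNn hK.2⟩ le_sup_left)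
  rwa [h]

theorem exists_normal_isPGroup_mem_of_mem_fittingSubgroup {p : ℕ} (hp : p.Prime) {y : G}
    (hy : y ∈ fittingSubgroup G) (hyp : y ^ p = 1) :
    ∃ R : Subgroup G, R.Normal ∧ IsPGroup p R ∧ y ∈ R := by
  have : Fact p.Prime := ⟨hp⟩
  obtain ⟨R, hR, hle, hRp, hRi⟩ := exists_normal_isPGroup_not_dvd_relIndex
    (fittingSubgroup_normal G) fittingSubgroup_isNilpotent p hp
  refine ⟨R, hR, hRp, ?_⟩
  let S : Sylow p (fittingSubgroup G) := IsPGroup.toSylow (P := R.subgroupOf (fittingSubgroup G))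
    (hRp.comap_of_injective _ (Subgroup.subtype_injective _)) hRi
  have hS : (S : Subgroup (fittingSubgroup G)).Normal := Subgroup.normal_subgroupOf
  have hsub : Subsingleton (Sylow p (fittingSubgroup G)) :=
    (Sylow.unique_of_normal S hS).instSubsingleton
  have hz : IsPGroup p (Subgroup.zpowers (⟨y, hy⟩ : fittingSubgroup G)) := by
    refine IsPGroup.of_card_dvd_pow (n := 1) ?_
    rw [Nat.card_zpowers, pow_one]
    exact orderOf_dvd_of_pow_eq_one (Subtype.ext hyp)
  obtain ⟨Q, hQ⟩ := hz.exists_le_sylow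
  have h1 := hQ (Subgroup.mem_zpowers _)
  rw [Subsingleton.elim Q S] at h1
  exact Subgroup.mem_subgroupOf.1 h1

/-- The intersection of the preimages of the two Fitting subgroups is normal and embeds into their
product, so it is nilpotent. -/
theorem mem_fittingSubgroup_of_quotients {N₁ N₂ : Subgroup G} [N₁.Normal] [N₂.Normal]
    (h : N₁ ⊓ N₂ = ⊥) {x : G} (h₁ : (x : G ⧸ N₁) ∈ fittingSubgroup (G ⧸ N₁))
    (h₂ : (x : G ⧸ N₂) ∈ fittingSubgroup (G ⧸ N₂)) : x ∈ fittingSubgroup G := by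
  let K₁ := (fittingSubgroup (G ⧸ N₁)).comap (QuotientGroup.mk' N₁)
  let K₂ := (fittingSubgroup (G ⧸ N₂)).comap (QuotientGroup.mk' N₂)
  have n₁ : Group.IsNilpotent (fittingSubgroup (G ⧸ N₁)) := fittingSubgroup_isNilpotent
  have n₂ : Group.IsNilpotent (fittingSubgroup (G ⧸ N₂)) := fittingSubgroup_isNilpotent
  let f₁ : (K₁ ⊓ K₂ : Subgroup G) →* fittingSubgroup (G ⧸ N₁) :=
    ((QuotientGroup.mk' N₁).comp (Subgroup.subtype _)).codRestrict _ fun a => a.2.1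
  let f₂ : (K₁ ⊓ K₂ : Subgroup G) →* fittingSubgroup (G ⧸ N₂) :=
    ((QuotientGroup.mk' N₂).comp (Subgroup.subtype _)).codRestrict _ fun a => a.2.2
  refine le_fittingSubgroup (N := K₁ ⊓ K₂) inferInstance ?_ ⟨h₁, h₂⟩
  refine Subgroup.isNilpotent_of_ker_le_center (f₁.prod f₂) ?_
  intro a ha
  have ha1 : f₁ a = 1 := congrArg Prod.fst ha
  have ha2 : f₂ a = 1 := congrArg Prod.snd ha
  have h1 : (a : G) ∈ N₁ ⊓ N₂ :=
    ⟨(QuotientGroup.eq_one_iff _).1 (congrArg Subtype.val ha1),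
      (QuotientGroup.eq_one_iff _).1 (congrArg Subtype.val ha2)⟩
  rw [h, Subgroup.mem_bot] at h1
  rw [show a = 1 from Subtype.ext h1]
  exact one_mem _

/-- The Frattini argument: a Sylow subgroup `S` of the preimage `N` of a normal `p`-subgroup
satisfies N = S M, so G = N_G(S) N = N_G(S) M. As `M` consists of non-generators, `S` is normal in
`G`. -/
theorem mem_fittingSubgroup_of_le_frattini {M : Subgroup G} [M.Normal] (hM : M ≤ frattini G) {x : G}
    (hx : (x : G ⧸ M) ∈ fittingSubgroup (G ⧸ M)) : x ∈ fittingSubgroup G := by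
  refine le_fittingSubgroup (N := (fittingSubgroup (G ⧸ M)).comap (QuotientGroup.mk' M))
    inferInstance (isNilpotent_of_forall_prime fun p hp => ?_) hx
  have : Fact p.Prime := ⟨hp⟩
  obtain ⟨R, hR, hle, hRp, hRi⟩ := exists_normal_isPGroup_not_dvd_relIndex
    (fittingSubgroup_normal (G ⧸ M)) fittingSubgroup_isNilpotent p hp
  let N : Subgroup G := R.comap (QuotientGroup.mk' M)
  let Q : Sylow p N := default
  let S : Subgroup G := (Q : Subgroup N).map N.subtype
  have hMN : M ≤ N := fun m hm => by
    rw [Subgroup.mem_comap, QuotientGroup.mk'_apply, (QuotientGroup.eq_one_iff m).2 hm]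
    exact one_mem _
  have hSN : S.relIndex N = (Q : Subgroup N).index := by
    rw [Subgroup.relIndex, Subgroup.subgroupOf, Subgroup.comap_map_eq_self_of_injective
      N.subtype_injective]
  have hN : N ≤ S ⊔ M := by
    rw [← Subgroup.relIndex_eq_one]
    have h1 : (S ⊔ M).relIndex N ∣ (Q : Subgroup N).index :=
      hSN ▸ Subgroup.relIndex_dvd_of_le_left N le_sup_left
    have h2 : (S ⊔ M).relIndex N ∣ Nat.card R := by
      have h3 := Subgroup.relIndex_ker (K := N) (QuotientGroup.mk' M)
      rw [QuotientGroup.ker_mk', Subgroup.map_comap_eq_self_of_surjective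
        (QuotientGroup.mk'_surjective M)] at h3
      exact h3 ▸ Subgroup.relIndex_dvd_of_le_left N le_sup_right
    obtain ⟨n, hn⟩ := IsPGroup.iff_card.1 hRp
    rw [hn] at h2
    obtain ⟨k, -, hk⟩ := (Nat.dvd_prime_pow hp).1 h2
    rw [hk] at h1 ⊢
    rcases Nat.eq_zero_or_pos k with rfl | hk0
    · exact pow_zero p
    · exact absurd ((dvd_pow_self p hk0.ne').trans h1) Q.not_dvd_index
  have hfr := Sylow.normalizer_sup_eq_top Q
  have hS : Subgroup.normalizer (S : Set G) = ⊤ := by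
    refine frattini_nongenerating (top_le_iff.1 ?_)
    rw [← hfr]
    exact sup_le le_sup_left (hN.trans (sup_le (Subgroup.le_normalizer.trans le_sup_left)
      (hM.trans le_sup_right)))
  refine ⟨S, Subgroup.normalizer_eq_top_iff.1 hS,
    (Subgroup.map_subtype_le _).trans (Subgroup.comap_mono hle), Q.2.map _, ?_⟩
  have hNi : N.relIndex ((fittingSubgroup (G ⧸ M)).comap (QuotientGroup.mk' M)) =
      R.relIndex (fittingSubgroup (G ⧸ M)) := by
    rw [Subgroup.relIndex_comap, Subgroup.map_comap_eq_self_of_surjective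
      (QuotientGroup.mk'_surjective M)]
  rw [← Subgroup.relIndex_mul_relIndex S N _ (Subgroup.map_subtype_le _)
    (Subgroup.comap_mono hle), hSN, hNi]
  exact hp.not_dvd_mul Q.not_dvd_index hRi

end Fitting

/-! ### Monomial representations and their irreducibility -/

section MonomialCharacters

variable {G : Type*} [Group G]

theorem isIrreducible_of_forall_submodule {W : Type*} [AddCommGroup W] [Module ℂ W] [Nontrivial W]
    {ρ : Representation ℂ G W}
    (h : ∀ U : Submodule ℂ W, (∀ g, ∀ v ∈ U, ρ g v ∈ U) → U = ⊥ ∨ U = ⊤) : ρ.IsIrreducible where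
  exists_pair_ne := ⟨⊥, ⊤, fun h => bot_ne_top (α := Submodule ℂ W)
    (congrArg Subrepresentation.toSubmodule h)⟩
  eq_bot_or_eq_top U := (h U.toSubmodule fun g _ hv => U.apply_mem_toSubmodule g hv).imp
    (fun h => Subrepresentation.toSubmodule_injective h)
    (fun h => Subrepresentation.toSubmodule_injective h)

theorem eq_bot_or_eq_top_of_isIrreducible {W : Type*} [AddCommGroup W] [Module ℂ W]
    {ρ : Representation ℂ G W} (hρ : ρ.IsIrreducible) (U : Submodule ℂ W)
    (hU : ∀ g, ∀ v ∈ U, ρ g v ∈ U) : U = ⊥ ∨ U = ⊤ :=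
  (hρ.eq_bot_or_eq_top ⟨U, fun g v hv => hU g v hv⟩).imp
    (fun h => congrArg Subrepresentation.toSubmodule h)
    (fun h => congrArg Subrepresentation.toSubmodule h)

theorem nontrivial_of_isIrreducible {W : Type*} [AddCommGroup W] [Module ℂ W]
    {ρ : Representation ℂ G W} (hρ : ρ.IsIrreducible) : Nontrivial W := by
  obtain ⟨a, b, hab⟩ := hρ.exists_pair_ne
  by_contra h
  rw [not_nontrivial_iff_subsingleton] at h
  exact hab (Subrepresentation.toSubmodule_injective (Subsingleton.elim _ _))

theorem character_mem_irrChars {W : Type*} [AddCommGroup W] [Module ℂ W] [Module.Finite ℂ W]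
    {ρ : Representation ℂ G W} (hρ : ρ.IsIrreducible) : ρ.character ∈ irrChars G := by
  have := nontrivial_of_isIrreducible hρ
  let e := (Module.finBasis ℂ W).equivFun
  let σ : Representation ℂ G (Fin (Module.finrank ℂ W) → ℂ) :=
    { toFun := fun g => e.conj (ρ g)
      map_one' := by ext; simp [LinearEquiv.conj_apply]
      map_mul' := fun a b => by ext; simp [LinearEquiv.conj_apply] }
  have hσ : ∀ g v, σ g v = e (ρ g (e.symm v)) := fun g v => rfl
  have := e.symm.nontrivial
  refine ⟨_, σ, isIrreducible_of_forall_submodule fun U hU => ?_, ?_⟩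
  · refine (eq_bot_or_eq_top_of_isIrreducible hρ (U.comap e.toLinearMap) fun g v hv => ?_).imp ?_ ?_
    · have := hU g _ hv
      rw [hσ] at this
      simpa using this
    · intro h
      rw [eq_bot_iff]
      intro v hv
      have h1 : e.symm v ∈ U.comap e.toLinearMap := by simpa using hv
      rw [h, Submodule.mem_bot] at h1
      simpa using h1
    · intro h
      rw [eq_top_iff]
      intro v _
      have h1 : e.symm v ∈ U.comap e.toLinearMap := h ▸ Submodule.mem_top
      simpa using h1
  · funext g
    exact LinearMap.trace_conj' (ρ g) e

open Classical in
/-- The extension by zero of a linear character of a subgroup. -/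
noncomputable def extendByZero (T : Subgroup G) (lam : T →* ℂˣ) (g : G) : ℂ :=
  if h : g ∈ T then (lam ⟨g, h⟩ : ℂ) else 0

variable {T : Subgroup G} {lam : T →* ℂˣ}

theorem extendByZero_of_mem {g : G} (h : g ∈ T) : extendByZero T lam g = lam ⟨g, h⟩ :=
  dif_pos h

theorem extendByZero_of_notMem {g : G} (h : g ∉ T) : extendByZero T lam g = 0 :=
  dif_neg h

theorem extendByZero_mul {a b : G} (ha : a ∈ T) (hb : b ∈ T) :
    extendByZero T lam (a * b) = extendByZero T lam a * extendByZero T lam b := by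
  rw [extendByZero_of_mem ha, extendByZero_of_mem hb, extendByZero_of_mem (mul_mem ha hb),
    ← Units.val_mul, ← map_mul]
  rfl

theorem extendByZero_one : extendByZero T lam 1 = 1 := by
  rw [extendByZero_of_mem (one_mem T)]
  exact congrArg Units.val (map_one lam)

theorem extendByZero_ne_zero {g : G} (h : g ∈ T) : extendByZero T lam g ≠ 0 := by
  rw [extendByZero_of_mem h]
  exact Units.ne_zero _

theorem extendByZero_conj {g t : G} (ht : t ∈ T) :
    extendByZero T lam (t⁻¹ * g * t) = extendByZero T lam g := by
  by_cases hg : g ∈ T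
  · have hti := inv_mem ht
    rw [extendByZero_mul (mul_mem hti hg) ht, extendByZero_mul hti hg, mul_right_comm,
      ← extendByZero_mul hti ht, inv_mul_cancel, extendByZero_one, one_mul]
  · rw [extendByZero_of_notMem hg, extendByZero_of_notMem]
    intro h
    have h1 := mul_mem (mul_mem ht h) (inv_mem ht)
    exact hg (by simpa [mul_assoc] using h1)

theorem inducedClassFunction_eq_sum [Fintype G] (g : G) :
    inducedClassFunction T (fun h => (lam h : ℂ)) g =
      (Nat.card T : ℂ)⁻¹ * ∑ t : G, extendByZero T lam (t⁻¹ * g * t) := by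
  rw [inducedClassFunction, finsum_eq_sum_of_fintype]
  rfl

theorem out_inv_mul_mul_out_mem (g : G) (c : G ⧸ T) : c.out⁻¹ * g * (g⁻¹ • c).out ∈ T := by
  rw [mul_assoc, ← QuotientGroup.eq, ← smul_eq_mul g, ← MulAction.Quotient.smul_mk]
  simp

variable (T lam) in
/-- The monomial representation induced from a linear character of `T`. -/
noncomputable def monomialRep : Representation ℂ G (G ⧸ T → ℂ) where
  toFun g :=
    { toFun := fun f c => extendByZero T lam (c.out⁻¹ * g * (g⁻¹ • c).out) * f (g⁻¹ • c)
      map_add' := fun f f' => by ext; simp [mul_add]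
      map_smul' := fun r f => by ext; simp [mul_left_comm] }
  map_one' := by
    ext f c
    simp [extendByZero_one]
  map_mul' a b := by
    refine LinearMap.ext fun f => funext fun c => ?_
    have h1 : (a * b)⁻¹ • c = b⁻¹ • a⁻¹ • c := by rw [mul_inv_rev, mul_smul]
    have h2 : c.out⁻¹ * (a * b) * (b⁻¹ • a⁻¹ • c).out =
        (c.out⁻¹ * a * (a⁻¹ • c).out) * ((a⁻¹ • c).out⁻¹ * b * (b⁻¹ • a⁻¹ • c).out) := by group
    simp only [LinearMap.coe_mk, AddHom.coe_mk, Module.End.mul_apply, h1, h2]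
    rw [extendByZero_mul (out_inv_mul_mul_out_mem _ _) (out_inv_mul_mul_out_mem _ _), mul_assoc]

theorem monomialRep_apply (g : G) (f : G ⧸ T → ℂ) (c : G ⧸ T) : monomialRep T lam g f c =
    extendByZero T lam (c.out⁻¹ * g * (g⁻¹ • c).out) * f (g⁻¹ • c) := rfl

theorem inv_smul_eq_self_iff (g : G) (c : G ⧸ T) : g⁻¹ • c = c ↔ c.out⁻¹ * g * c.out ∈ T := by
  rw [inv_smul_eq_iff, mul_assoc, ← QuotientGroup.eq, ← smul_eq_mul g,
    ← MulAction.Quotient.smul_mk]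
  simp

/-- Only cosets fixed by `g` contribute to the trace. In the sum over `G`, each coset accounts for
|T| equal terms. -/
theorem character_monomialRep [Finite G] :
    (monomialRep T lam).character = inducedClassFunction T fun h => (lam h : ℂ) := by
  classical
  let _ : Fintype G := Fintype.ofFinite G
  let _ : Fintype (G ⧸ T) := Fintype.ofFinite _
  let _ : Fintype T := Fintype.ofFinite _
  funext g
  have h1 : (monomialRep T lam).character g =
      ∑ c : G ⧸ T, extendByZero T lam (c.out⁻¹ * g * c.out) := by
    rw [Representation.character, LinearMap.trace_eq_matrix_trace ℂ (Pi.basisFun ℂ (G ⧸ T)),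
      Matrix.trace]
    refine Finset.sum_congr rfl fun c _ => ?_
    rw [Matrix.diag_apply, LinearMap.toMatrix_apply, Pi.basisFun_apply, Pi.basisFun_repr,
      monomialRep_apply]
    by_cases hc : g⁻¹ • c = c
    · rw [hc, Pi.single_eq_same, mul_one]
    · rw [Pi.single_eq_of_ne hc, mul_zero,
        extendByZero_of_notMem ((inv_smul_eq_self_iff g c).not.1 hc)]
  have hbij : Function.Bijective fun q : (G ⧸ T) × T => q.1.out * (q.2 : G) := by
    have hmk : ∀ (c : G ⧸ T) (t : T), ((c.out * (t : G) : G) : G ⧸ T) = c := fun c t => by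
      rw [QuotientGroup.mk_mul_of_mem _ t.2]
      exact Quotient.out_eq' c
    constructor
    · rintro ⟨c, t⟩ ⟨c', t'⟩ h
      have hc : c = c' := by rw [← hmk c t, ← hmk c' t']; exact congrArg _ h
      subst hc
      exact Prod.ext rfl (Subtype.ext (mul_left_cancel h))
    · intro g
      refine ⟨(g, ⟨(QuotientGroup.mk g : G ⧸ T).out⁻¹ * g, ?_⟩), mul_inv_cancel_left _ _⟩
      exact QuotientGroup.eq.1 (Quotient.out_eq' _)
  have h2 : ∑ t : G, extendByZero T lam (t⁻¹ * g * t) =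
      Nat.card T * ∑ c : G ⧸ T, extendByZero T lam (c.out⁻¹ * g * c.out) := by
    rw [← hbij.sum_comp, Fintype.sum_prod_type, Finset.mul_sum]
    refine Finset.sum_congr rfl fun c _ => ?_
    have hterm : ∀ t : T, extendByZero T lam ((c.out * (t : G))⁻¹ * g * (c.out * (t : G))) =
        extendByZero T lam (c.out⁻¹ * g * c.out) := fun t => by
      rw [← extendByZero_conj (g := c.out⁻¹ * g * c.out) t.2]
      congr 1
      simp only [mul_inv_rev, mul_assoc]
    rw [Finset.sum_congr rfl fun t _ => hterm t, Finset.sum_const, Finset.card_univ,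
      nsmul_eq_mul, Nat.card_eq_fintype_card]
  rw [h1, inducedClassFunction_eq_sum, h2, inv_mul_cancel_left₀]
  exact Nat.cast_ne_zero.2 Nat.card_pos.ne'

/-- `N` acts on the coordinate of each coset by a linear character, and `hsep` makes these distinct.
Averaging therefore isolates a coordinate line in any nonzero submodule, and `G` permutes those
lines transitively. -/
theorem monomialRep_isIrreducible [Finite G] {N : Subgroup G} [N.Normal] (hNT : N ≤ T)
    (hsep : ∀ g ∉ T, ∃ n ∈ N, extendByZero T lam (g⁻¹ * n * g) ≠ extendByZero T lam n) :
    (monomialRep T lam).IsIrreducible := by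
  classical
  let _ : Fintype (G ⧸ T) := Fintype.ofFinite _
  let _ : Fintype N := Fintype.ofFinite _
  have hconj : ∀ (g : G) (n : N), g⁻¹ * n * g ∈ T := fun g n => hNT (by
    have := ‹N.Normal›.conj_mem n n.2 g⁻¹
    rwa [inv_inv] at this)
  let ψ : G → N →* ℂ := fun g =>
    { toFun := fun n => extendByZero T lam (g⁻¹ * n * g)
      map_one' := by simp [extendByZero_one]
      map_mul' := fun a b => by
        rw [← extendByZero_mul (hconj g a) (hconj g b)]
        congr 1
        simp [mul_assoc] }
  have hψ : ∀ (n : N) (f : G ⧸ T → ℂ) (c : G ⧸ T),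
      monomialRep T lam n f c = ψ c.out n * f c := by
    intro n f c
    rw [monomialRep_apply, (inv_smul_eq_self_iff _ c).2 (hconj _ n)]
    rfl
  have hψinv : ∀ (g : G) (n : N), ψ g n⁻¹ * ψ g n = 1 := fun g n => by
    rw [← map_mul, inv_mul_cancel, map_one]
  refine isIrreducible_of_forall_submodule fun U hU => or_iff_not_imp_left.2 fun hne => ?_
  obtain ⟨f, hf, hf0⟩ := (Submodule.ne_bot_iff U).1 hne
  obtain ⟨c, hc⟩ := Function.ne_iff.1 hf0
  have hproj : ∑ n : N, ψ c.out n⁻¹ • monomialRep T lam n f ∈ U :=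
    sum_mem fun n _ => U.smul_mem _ (hU _ _ hf)
  have hval : ∑ n : N, ψ c.out n⁻¹ • monomialRep T lam n f =
      (Nat.card N * f c : ℂ) • Pi.single c 1 := by
    funext d
    rw [Finset.sum_apply]
    simp only [Pi.smul_apply, smul_eq_mul, hψ, ← mul_assoc, ← Finset.sum_mul]
    by_cases hd : d = c
    · subst hd
      rw [Finset.sum_congr rfl fun n _ => hψinv _ n]
      simp
    · rw [Pi.single_eq_of_ne hd, mul_zero]
      let θ : N →* ℂ :=
        { toFun := fun n => ψ c.out n⁻¹ * ψ d.out n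
          map_one' := by simp
          map_mul' := fun a b => by rw [mul_inv_rev, map_mul, map_mul]; ring }
      have hθ : θ ≠ 1 := by
        intro h
        have hT : c.out⁻¹ * d.out ∉ T := by
          rw [← QuotientGroup.eq, QuotientGroup.out_eq', QuotientGroup.out_eq']
          exact fun h => hd h.symm
        obtain ⟨n, hn, hne⟩ := hsep _ hT
        let n' : N := ⟨c.out * n * c.out⁻¹, ‹N.Normal›.conj_mem n hn _⟩
        have h1 : ψ c.out n'⁻¹ * ψ d.out n' = 1 := DFunLike.congr_fun h n'
        have h2 : ψ d.out n' = ψ c.out n' := by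
          have h3 := hψinv c.out n'
          exact mul_left_cancel₀ (left_ne_zero_of_mul_eq_one h1) (h1.trans h3.symm)
        apply hne
        have e1 : ψ d.out n' = extendByZero T lam ((c.out⁻¹ * d.out)⁻¹ * n * (c.out⁻¹ * d.out)) :=
          congrArg (extendByZero T lam) (show d.out⁻¹ * (c.out * n * c.out⁻¹) * d.out = _ by group)
        have e2 : ψ c.out n' = extendByZero T lam n :=
          congrArg (extendByZero T lam) (show c.out⁻¹ * (c.out * n * c.out⁻¹) * c.out = _ by group)
        rw [← e1, ← e2, h2]
      have h4 : ∑ n : N, ψ c.out n⁻¹ * ψ d.out n = 0 := sum_hom_units_eq_zero θ hθ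
      rw [h4, zero_mul]
  rw [hval] at hproj
  have hcard : (Nat.card N * f c : ℂ) ≠ 0 := mul_ne_zero (Nat.cast_ne_zero.2 Nat.card_pos.ne') hc
  have hsingle : (Pi.single c 1 : G ⧸ T → ℂ) ∈ U := (U.smul_mem_iff hcard).1 hproj
  have hall : ∀ d : G ⧸ T, (Pi.single d 1 : G ⧸ T → ℂ) ∈ U := by
    intro d
    obtain ⟨g, rfl⟩ := MulAction.exists_smul_eq G c d
    have h1 : monomialRep T lam g (Pi.single c 1) =
        extendByZero T lam ((g • c).out⁻¹ * g * c.out) • Pi.single (g • c) 1 := by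
      funext d
      rw [monomialRep_apply, Pi.smul_apply, smul_eq_mul]
      by_cases hd : d = g • c
      · subst hd
        simp
      · rw [Pi.single_eq_of_ne hd, Pi.single_eq_of_ne, mul_zero, mul_zero]
        rwa [ne_eq, inv_smul_eq_iff]
    have h2 := hU g _ hsingle
    rw [h1] at h2
    refine (U.smul_mem_iff (extendByZero_ne_zero ?_)).1 h2
    have := out_inv_mul_mul_out_mem g (g • c)
    rwa [inv_smul_smul] at this
  rw [eq_top_iff]
  intro f' _
  have h3 : f' = ∑ d : G ⧸ T, f' d • (Pi.single d 1 : G ⧸ T → ℂ) := by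
    funext d
    simp [Finset.sum_apply, Pi.single_apply]
  rw [h3]
  exact sum_mem fun d _ => U.smul_mem _ (hall d)

end MonomialCharacters

/-! ### Monomial-non-vanishing elements -/

section MonomialNonvanishing

variable {G : Type*} [Group G]

theorem sum_comp_of_surjective {G' : Type*} [Group G'] [Fintype G] [Fintype G'] {f : G →* G'}
    (hf : Function.Surjective f) :
    ∃ k : ℂ, k ≠ 0 ∧ ∀ F : G' → ℂ, ∑ t : G, F (f t) = k * ∑ t : G', F t := by
  classical
  refine ⟨(Finset.univ.filter fun t => f t = 1).card, Nat.cast_ne_zero.2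
    (Finset.card_ne_zero.2 ⟨1, by simp⟩), fun F => ?_⟩
  rw [← Finset.sum_fiberwise Finset.univ f, Finset.mul_sum]
  refine Finset.sum_congr rfl fun a _ => ?_
  rw [Finset.sum_congr rfl fun t ht => congrArg F (Finset.mem_filter.1 ht).2, Finset.sum_const,
    nsmul_eq_mul, MonoidHom.card_fiber_eq_of_mem_range f (hf a) (hf 1)]

/-- The inflation of an irreducible character induced from `H` is irreducible and induced from the
preimage of `H`. -/
theorem monomialNonvanishing_map [Finite G] {G' : Type*} [Group G'] {f : G →* G'}
    (hf : Function.Surjective f) {x : G} (hx : x ∈ monomialNonvanishing G) :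
    f x ∈ monomialNonvanishing G' := by
  classical
  have : Finite G' := Finite.of_surjective f hf
  let _ : Fintype G := Fintype.ofFinite G
  let _ : Fintype G' := Fintype.ofFinite G'
  rintro χ ⟨⟨n, ρ, hρ, rfl⟩, H, lam, hlam⟩
  refine hx (fun g => ρ.character (f g)) ⟨⟨n, ρ.comp f, ?_, rfl⟩, H.comap f,
    lam.comp (f.subgroupComap H), ?_⟩
  · have := nontrivial_of_isIrreducible hρ
    refine isIrreducible_of_forall_submodule fun U hU =>
      eq_bot_or_eq_top_of_isIrreducible hρ U fun g v hv => ?_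
    obtain ⟨h, rfl⟩ := hf g
    exact hU h v hv
  · obtain ⟨k, hk, hsum⟩ := sum_comp_of_surjective hf
    have hcard : (Nat.card (H.comap f) : ℂ) = k * Nat.card H := by
      have h1 := hsum fun g => if g ∈ H then 1 else 0
      rw [Finset.sum_boole, Finset.sum_boole] at h1
      rw [Nat.card_eq_fintype_card, Nat.card_eq_fintype_card, Fintype.card_subtype,
        Fintype.card_subtype]
      exact h1
    have hext : ∀ g : G, extendByZero (H.comap f) (lam.comp (f.subgroupComap H)) g =
        extendByZero H lam (f g) := fun g => rfl
    funext g
    have h2 := hsum fun t => extendByZero H lam (t⁻¹ * f g * t)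
    rw [hlam, inducedClassFunction_eq_sum]
    refine Eq.trans ?_ (inducedClassFunction_eq_sum (T := H.comap f)
      (lam := lam.comp (f.subgroupComap H)) g).symm
    simp only [hext, map_mul, map_inv]
    rw [h2, hcard, mul_inv, mul_mul_mul_comm, inv_mul_cancel₀ hk, one_mul]

/-- A monomial-non-vanishing element of a split extension of an abelian group `M` is, for each
linear character of `M`, conjugate to an element that stabilizes it. -/
theorem exists_conj_stabilizes_of_monomialNonvanishing [Finite G] {M : Subgroup G} [M.Normal]
    (hM : ∀ a ∈ M, ∀ b ∈ M, Commute a b) {L : Subgroup G} (f : G →* L) (hfM : f.ker = M)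
    (hfL : ∀ l : L, f l = l) {x : G} (hx : x ∈ monomialNonvanishing G) (lam : M →* ℂˣ) :
    ∃ t : G, ∀ m : M, lam (MulAut.conjNormal (t⁻¹ * x * t) m) = lam m := by
  let T : Subgroup G :=
    { carrier := {g | ∀ m : M, lam (MulAut.conjNormal g m) = lam m}
      one_mem' := fun m => by simp
      mul_mem' := fun {a b} ha hb m => by rw [map_mul, MulAut.mul_apply, ha, hb]
      inv_mem' := fun {a} ha m => by
        rw [← ha, ← MulAut.mul_apply, ← map_mul, mul_inv_cancel, map_one, MulAut.one_apply] }
  have hT : ∀ {g : G}, g ∈ T ↔ ∀ m : M, lam (MulAut.conjNormal g m) = lam m := Iff.rfl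
  have hMT : M ≤ T := fun a ha m => by
    congr 1
    ext
    rw [MulAut.conjNormal_apply, (hM a ha m m.2).eq, mul_inv_cancel_right]
  have hf1 : ∀ m ∈ M, f m = 1 := fun m hm => by
    rwa [← MonoidHom.mem_ker, hfM]
  have hproj : ∀ g : G, g * ((f g : L) : G)⁻¹ ∈ M := fun g => by
    rw [← hfM, MonoidHom.mem_ker, map_mul, map_inv, hfL, mul_inv_cancel]
  -- `lam` is extended to its stabilizer by being trivial on the complement part; it is
  -- multiplicative because `T` fixes `lam`.
  let lam' : T →* ℂˣ :=
    { toFun := fun t => lam ⟨t * ((f t : L) : G)⁻¹, hproj t⟩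
      map_one' := by
        rw [← map_one lam]
        congr 1
        ext
        simp
      map_mul' := fun a b => by
        rw [← a.2 ⟨b * ((f b : L) : G)⁻¹, hproj b⟩, mul_comm, ← map_mul]
        congr 1
        ext
        simp [mul_assoc] }
  have hlam' : ∀ m : M, extendByZero T lam' m = lam m := fun m => by
    rw [extendByZero_of_mem (hMT m.2)]
    refine congrArg Units.val (congrArg lam (Subtype.ext ?_))
    simp [hf1 m m.2]
  have hirr : (monomialRep T lam').IsIrreducible := by
    refine monomialRep_isIrreducible hMT fun g hg => ?_
    rw [hT] at hg
    push Not at hg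
    obtain ⟨m, hm⟩ := hg
    refine ⟨MulAut.conjNormal g m, Subtype.coe_prop _, fun h => hm (Units.ext ?_)⟩
    rw [← hlam', ← hlam', ← h]
    congr 1
    rw [MulAut.conjNormal_apply]
    group
  have hne := hx _ ⟨character_mem_irrChars hirr, T, lam', character_monomialRep⟩
  by_contra! hcon
  apply hne
  let _ : Fintype G := Fintype.ofFinite G
  -- If no conjugate of `x` lies in `T`, every term of the induced character vanishes at `x`.
  rw [character_monomialRep, inducedClassFunction_eq_sum, Finset.sum_eq_zero, mul_zero]
  intro t _
  refine extendByZero_of_notMem fun h => ?_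
  obtain ⟨m, hm⟩ := hcon t
  exact hm (h m)

/-- A subgroup of the dual of a finite abelian group that separates points is everything. -/
theorem eq_top_of_forall_apply_eq_one {A : Type*} [CommGroup A] [Finite A] (U : Subgroup (A →* ℂˣ))
    (h : ∀ a : A, (∀ φ ∈ U, φ a = 1) → a = 1) : U = ⊤ := by
  have : Finite (A →* ℂˣ) := Nat.finite_of_card_ne_zero
    ((CommGroup.card_monoidHom_of_hasEnoughRootsOfUnity A ℂ) ▸ Nat.card_pos.ne')
  have : NeZero (Monoid.exponent (A →* ℂˣ)) := ⟨ne_zero_of_dvd_ne_zero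
    (Monoid.exponent_ne_zero_of_finite (G := A)) (Monoid.exponent_dvd_of_forall_pow_eq_one
      fun φ => by
        ext a
        rw [MonoidHom.pow_apply, ← map_pow, Monoid.pow_exponent_eq_one, map_one,
          MonoidHom.one_apply])⟩
  rw [eq_top_iff]
  intro φ _
  rw [← CommGroup.forall_monoidHom_apply_eq_one_iff ℂ U φ]
  intro η hη
  rw [← CommGroup.apply_monoidHomMonoidHomEquiv, h (CommGroup.monoidHomMonoidHomEquiv A ℂ η),
    map_one]
  intro ψ hψ
  rw [CommGroup.apply_monoidHomMonoidHomEquiv]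
  exact hη ψ hψ

end MonomialNonvanishing

/-! ### Reduction to a split extension, and conclusion -/

section Main

theorem normal_of_normalized_by_complement {G : Type*} [Group G] {M L N : Subgroup G} [M.Normal]
    (hML : M ⊔ L = ⊤) (hM : ∀ m ∈ M, ∀ n ∈ N, m * n * m⁻¹ ∈ N)
    (hL : ∀ l ∈ L, ∀ n ∈ N, l * n * l⁻¹ ∈ N) : N.Normal := by
  refine ⟨fun n hn g => ?_⟩
  obtain ⟨m, hm, l, hl, rfl⟩ := Subgroup.mem_sup_of_normal_left.1 (hML ▸ Subgroup.mem_top g)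
  have := hM m hm _ (hL l hl n hn)
  simpa [mul_assoc] using this

/-- The retraction of a split extension onto the complement. -/
theorem exists_retraction {G : Type*} [Group G] {M L : Subgroup G} [M.Normal]
    (hML : M ⊔ L = ⊤) (hdisj : M ⊓ L = ⊥) :
    ∃ f : G →* L, f.ker = M ∧ ∀ l : L, f l = l := by
  let i : L →* G ⧸ M := (QuotientGroup.mk' M).comp L.subtype
  have hi : Function.Bijective i := by
    constructor
    · rw [injective_iff_map_eq_one]
      intro l hl
      have h1 : (l : G) ∈ M ⊓ L := ⟨(QuotientGroup.eq_one_iff _).1 hl, l.2⟩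
      rw [hdisj, Subgroup.mem_bot] at h1
      exact Subtype.ext h1
    · intro q
      obtain ⟨g, rfl⟩ := QuotientGroup.mk'_surjective M q
      obtain ⟨m, hm, l, hl, rfl⟩ := Subgroup.mem_sup_of_normal_left.1 (hML ▸ Subgroup.mem_top g)
      refine ⟨⟨l, hl⟩, ?_⟩
      have h1 : QuotientGroup.mk' M m = 1 := (QuotientGroup.eq_one_iff m).2 hm
      rw [map_mul, h1, one_mul]
      rfl
  let e : L ≃* G ⧸ M := MulEquiv.ofBijective i hi
  refine ⟨e.symm.toMonoidHom.comp (QuotientGroup.mk' M), ?_, fun l => e.symm_apply_apply l⟩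
  ext g
  rw [MonoidHom.mem_ker]
  exact (map_eq_one_iff e.symm e.symm.injective).trans (QuotientGroup.eq_one_iff g)

/-- Otherwise `M` equals its commutator subgroup and lies in every term of the derived series. -/
theorem commute_of_minimal_normal {G : Type*} [Group G] [Group.IsSolvable G] {M : Subgroup G}
    [M.Normal] (hM : M ≠ ⊥) (hmin : ∀ N : Subgroup G, N.Normal → N ≠ ⊥ → N ≤ M → M ≤ N) :
    ∀ a ∈ M, ∀ b ∈ M, Commute a b := by
  have hbot : ⁅M, M⁆ = ⊥ := by
    by_contra hne
    have hle : M ≤ ⁅M, M⁆ := hmin _ inferInstance hne (Subgroup.commutator_le_left M M)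
    have hder : ∀ n, M ≤ derivedSeries G n := by
      intro n
      induction n with
      | zero => exact le_top
      | succ n ih => exact hle.trans (Subgroup.commutator_mono ih ih)
    obtain ⟨n, hn⟩ := Group.IsSolvable.solvable (G := G)
    exact hM (le_bot_iff.1 (hn ▸ hder n))
  intro a ha b hb
  exact (Subgroup.mem_centralizer_iff.1 (Subgroup.commutator_eq_bot_iff_le_centralizer.1 hbot ha)
    b hb).symm

/-- The action of `L` on the dual of a normal subgroup `M` by conjugation. -/
@[reducible]
def dualConjAction {G : Type*} [Group G] (M L : Subgroup G) [M.Normal] :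
    DistribMulAction L (Additive (M →* ℂˣ)) where
  smul l φ := .ofMul (φ.toMul.comp (MulAut.conjNormal (l : G)⁻¹ : MulAut M).toMonoidHom)
  one_smul φ := by
    apply Additive.toMul.injective
    ext m
    change ((φ.toMul (MulAut.conjNormal ((1 : L) : G)⁻¹ m) : ℂˣ) : ℂ) = _
    simp
  mul_smul a b φ := by
    apply Additive.toMul.injective
    ext m
    change ((φ.toMul (MulAut.conjNormal ((a * b : L) : G)⁻¹ m) : ℂˣ) : ℂ) =
      φ.toMul (MulAut.conjNormal ((b : L) : G)⁻¹ (MulAut.conjNormal ((a : L) : G)⁻¹ m))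
    rw [Subgroup.coe_mul, mul_inv_rev, map_mul, MulAut.mul_apply]
  smul_zero a := rfl
  smul_add a φ ψ := rfl

/-- Let `L` be a complement of a minimal normal subgroup `M` whose centralizer meets `L` trivially.
For an element `y` of odd prime order in the Fitting subgroup of `L`, some linear character of `M`
is fixed by no `L`-conjugate of `y`. -/
theorem exists_character_not_fixed {G : Type*} [Group G] [Finite G] {M L : Subgroup G} [M.Normal]
    (hM : ∀ a ∈ M, ∀ b ∈ M, Commute a b)
    (hmin : ∀ N : Subgroup G, N.Normal → N ≠ ⊥ → N ≤ M → M ≤ N)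
    (hML : M ⊔ L = ⊤) (hcent : Subgroup.centralizer (M : Set G) ⊓ L = ⊥) {p : ℕ} (hp : p.Prime)
    (hp2 : Odd p) {y : L} (hy : y ∈ fittingSubgroup L) (hyp : y ^ p = 1) (hy1 : y ≠ 1) :
    ∃ lam : M →* ℂˣ, ∀ h : L, ∃ m : M,
      lam (MulAut.conjNormal ((h * y * h⁻¹ : L) : G) m) ≠ lam m := by
  have : Fact p.Prime := ⟨hp⟩
  let _ : CommGroup M := { (inferInstance : Group M) with
    mul_comm := fun a b => Subtype.ext (hM a a.2 b b.2) }
  have hfin : Finite (M →* ℂˣ) := Nat.finite_of_card_ne_zero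
    ((CommGroup.card_monoidHom_of_hasEnoughRootsOfUnity M ℂ) ▸ Nat.card_pos.ne')
  let _ : DistribMulAction L (Additive (M →* ℂˣ)) := dualConjAction M L
  have hfinV : Finite (Additive (M →* ℂˣ)) := hfin
  have hsmul : ∀ (l : L) (φ : M →* ℂˣ) (m : M),
      (l • Additive.ofMul φ).toMul m = φ (MulAut.conjNormal (l : G)⁻¹ m) := fun _ _ _ => rfl
  have hirr : ∀ U : AddSubgroup (Additive (M →* ℂˣ)), (∀ l : L, ∀ u ∈ U, l • u ∈ U) →
      U = ⊥ ∨ U = ⊤ := by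
    intro U hU
    -- The common kernel of the characters in `U` is normal in `G`, so it is trivial or `M`. By
    -- duality `U` is then everything or zero.
    let N : Subgroup G :=
      { carrier := {g | ∃ h : g ∈ M, ∀ φ ∈ U, φ.toMul ⟨g, h⟩ = 1}
        one_mem' := ⟨one_mem M, fun φ _ => map_one φ.toMul⟩
        mul_mem' := by
          rintro a b ⟨ha, ha'⟩ ⟨hb, hb'⟩
          refine ⟨mul_mem ha hb, fun φ hφ => ?_⟩
          have := map_mul φ.toMul ⟨a, ha⟩ ⟨b, hb⟩
          rw [ha' φ hφ, hb' φ hφ, mul_one] at this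
          exact this
        inv_mem' := by
          rintro a ⟨ha, ha'⟩
          refine ⟨inv_mem ha, fun φ hφ => ?_⟩
          have := map_inv φ.toMul ⟨a, ha⟩
          rw [ha' φ hφ, inv_one] at this
          exact this }
    have hNM : N ≤ M := fun g hg => hg.1
    have hN : N.Normal := by
      refine normal_of_normalized_by_complement hML (fun m hm n hn => ?_) fun l hl n hn => ?_
      · rwa [(hM m hm n (hNM hn)).eq, mul_inv_cancel_right]
      · refine ⟨‹M.Normal›.conj_mem n hn.1 l, fun φ hφ => ?_⟩
        have h1 := hn.2 _ (hU (⟨l, hl⟩⁻¹ : L) φ hφ)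
        rw [← h1]
        refine congrArg φ.toMul (Subtype.ext ?_)
        simp
    by_cases hNb : N = ⊥
    · right
      have h1 : (AddSubgroup.toSubgroup' U : Subgroup (M →* ℂˣ)) = ⊤ := by
        refine eq_top_of_forall_apply_eq_one _ fun a ha => ?_
        have h2 : (a : G) ∈ N := ⟨a.2, fun φ hφ => ha φ.toMul hφ⟩
        rw [hNb, Subgroup.mem_bot] at h2
        exact Subtype.ext h2
      rw [eq_top_iff]
      intro φ _
      have h2 : φ.toMul ∈ (AddSubgroup.toSubgroup' U : Subgroup (M →* ℂˣ)) := h1 ▸ Subgroup.mem_top _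
      exact h2
    · left
      rw [eq_bot_iff]
      intro φ hφ
      rw [AddSubgroup.mem_bot]
      apply Additive.toMul.injective
      ext m
      exact congrArg Units.val ((hmin N hN hNb hNM m.2).2 φ hφ)
  obtain ⟨R, hR, hRp, hyR⟩ := exists_normal_isPGroup_mem_of_mem_fittingSubgroup hp hy hyp
  have hyV : ∃ φ : Additive (M →* ℂˣ), y • φ ≠ φ := by
    by_contra! h
    apply hy1
    have h1 : ∀ m : M, MulAut.conjNormal (y : G)⁻¹ m = m := fun m =>
      (CommGroup.forall_apply_eq_apply_iff (M := ℂ) (G := M)).1 fun φ => by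
        rw [← hsmul, h]
        rfl
    have h2 : (y : G)⁻¹ ∈ Subgroup.centralizer (M : Set G) ⊓ L := by
      refine ⟨Subgroup.mem_centralizer_iff.2 fun m hm => ?_, L.inv_mem y.2⟩
      have h3 := congrArg Subtype.val (h1 ⟨m, hm⟩)
      rw [MulAut.conjNormal_apply, mul_inv_eq_iff_eq_mul] at h3
      exact h3.symm
    rw [hcent, Subgroup.mem_bot, inv_eq_one] at h2
    exact Subtype.ext h2
  obtain ⟨φ, hφ⟩ := exists_forall_conj_smul_ne (V := Additive (M →* ℂˣ)) hp2 hirr hRp hyR hyp hyV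
  refine ⟨φ.toMul, fun h => ?_⟩
  by_contra! hcon
  refine hφ h ?_
  rw [← inv_inv (h * y * h⁻¹), inv_smul_eq_iff]
  apply Additive.toMul.injective
  ext m
  rw [← hcon m]
  refine congrArg Units.val (congrArg φ.toMul ?_)
  simp

theorem exists_pow_two_pow_mem_fittingSubgroup :
    ∀ (n : ℕ) (G : Type*) [Group G] [Finite G] [Group.IsSolvable G], Nat.card G = n →
      ∀ x ∈ monomialNonvanishing G, ∃ k : ℕ, x ^ 2 ^ k ∈ fittingSubgroup G := by
  intro n
  induction n using Nat.strong_induction_on with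
  | _ n ih =>
    intro G _ _ _ hn x hx
    have hquot : ∀ N : Subgroup G, ∀ _ : N.Normal, N ≠ ⊥ →
        ∃ k : ℕ, ((x ^ 2 ^ k : G) : G ⧸ N) ∈ fittingSubgroup (G ⧸ N) := by
      intro N _ hN
      refine ih (Nat.card (G ⧸ N)) ?_ (G ⧸ N) rfl (QuotientGroup.mk' N x)
        (monomialNonvanishing_map (QuotientGroup.mk'_surjective N) hx)
      have h1 := Subgroup.card_eq_card_quotient_mul_card_subgroup N
      rw [hn] at h1
      rw [h1]
      exact lt_mul_of_one_lt_right Nat.card_pos ((Subgroup.one_lt_card_iff_ne_bot N).2 hN)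
    by_cases htriv : (⊤ : Subgroup G) = ⊥
    · refine ⟨0, ?_⟩
      have : x ^ 2 ^ 0 ∈ (⊥ : Subgroup G) := htriv ▸ Subgroup.mem_top _
      rw [Subgroup.mem_bot.1 this]
      exact one_mem _
    by_cases hdis : ∃ N₁ N₂ : Subgroup G, N₁.Normal ∧ N₂.Normal ∧ N₁ ≠ ⊥ ∧ N₂ ≠ ⊥ ∧ N₁ ⊓ N₂ = ⊥
    · obtain ⟨N₁, N₂, h₁, h₂, hne₁, hne₂, hinf⟩ := hdis
      obtain ⟨k₁, hk₁⟩ := hquot N₁ h₁ hne₁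
      obtain ⟨k₂, hk₂⟩ := hquot N₂ h₂ hne₂
      refine ⟨k₁ + k₂, mem_fittingSubgroup_of_quotients hinf ?_ ?_⟩
      · rw [pow_add, pow_mul]
        exact pow_mem hk₁ _
      · rw [pow_add, mul_comm, pow_mul]
        exact pow_mem hk₂ _
    obtain ⟨M, ⟨hMn, hMb⟩, hmin'⟩ := (Set.toFinite
      {N : Subgroup G | N.Normal ∧ N ≠ ⊥}).exists_minimal ⟨⊤, inferInstance, htriv⟩
    have hmin : ∀ N : Subgroup G, N.Normal → N ≠ ⊥ → N ≤ M → M ≤ N :=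
      fun N hN hNb hle => hmin' ⟨hN, hNb⟩ hle
    have hM := commute_of_minimal_normal hMb hmin
    by_cases hfr : M ≤ frattini G
    · exact (hquot M hMn hMb).imp fun k hk => mem_fittingSubgroup_of_le_frattini hfr hk
    obtain ⟨L, hL, hMnL⟩ : ∃ L : Subgroup G, IsCoatom L ∧ ¬ M ≤ L := by
      by_contra! h
      exact hfr (le_iInf₂ fun L hL => h L hL)
    have hML : M ⊔ L = ⊤ := hL.2 _ (right_lt_sup.2 hMnL)
    have hinf : M ⊓ L = ⊥ := by
      by_contra hne
      refine hMnL ((hmin _ ?_ hne inf_le_left).trans inf_le_right)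
      refine normal_of_normalized_by_complement hML (fun m hm a ha => ?_) fun l hl a ha => ?_
      · rwa [(hM m hm a ha.1).eq, mul_inv_cancel_right]
      · exact ⟨hMn.conj_mem a ha.1 l,
          L.mul_mem (L.mul_mem hl ha.2) (L.inv_mem hl)⟩
    -- The left side is normal in `G` and meets `M` trivially, which `hdis` rules out for a
    -- nontrivial subgroup.
    have hcent : Subgroup.centralizer (M : Set G) ⊓ L = ⊥ := by
      by_contra hne
      refine hdis ⟨_, M, ?_, hMn, hne, hMb, ?_⟩
      · refine normal_of_normalized_by_complement hML (fun m hm a ha => ?_) fun l hl a ha => ?_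
        · rwa [Subgroup.mem_centralizer_iff.1 ha.1 m hm, mul_inv_cancel_right]
        · exact ⟨Subgroup.normal_centralizer.conj_mem a ha.1 l,
            L.mul_mem (L.mul_mem hl ha.2) (L.inv_mem hl)⟩
      · rw [inf_assoc, inf_comm L, hinf, inf_bot_eq]
    obtain ⟨f, hfM, hfL⟩ := exists_retraction hML hinf
    have hfsurj : Function.Surjective f := fun l => ⟨l, hfL l⟩
    have hLcard : Nat.card L < n := hn ▸ lt_of_le_of_ne (Subgroup.card_le_card_group L)
      (fun h => hL.1 ((Subgroup.card_eq_iff_eq_top L).1 h))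
    obtain ⟨k, hk⟩ := ih _ hLcard L rfl (f x) (monomialNonvanishing_map hfsurj hx)
    rcases Nat.eq_two_pow_or_exists_odd_prime_and_dvd (orderOf (f x)) with ⟨j, hj⟩ | ⟨p, hp, hpd, hp2⟩
    · have hMnil : Group.IsNilpotent M := by
        let _ : CommGroup M := { (inferInstance : Group M) with
          mul_comm := fun a b => Subtype.ext (hM a a.2 b b.2) }
        exact CommGroup.isNilpotent
      refine ⟨j, le_fittingSubgroup hMn hMnil ?_⟩
      rw [← hfM, MonoidHom.mem_ker, map_pow, ← hj, pow_orderOf_eq_one]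
    exfalso
    set q := orderOf (f x) / p with hq
    have hqp : q * p = orderOf (f x) := Nat.div_mul_cancel hpd
    have hord : orderOf (f x ^ q) = p := orderOf_pow_orderOf_div (orderOf_pos _).ne' hpd
    -- `f x ^ q` has order `p`. Its `2 ^ k`-th power is still nontrivial because `p` is odd, and
    -- lies in the Fitting subgroup of `L` by induction.
    obtain ⟨lam, hlam⟩ := exists_character_not_fixed hM hmin hML hcent hp hp2
      (y := (f x ^ 2 ^ k) ^ q) (pow_mem hk q)
      (by rw [← pow_mul, ← pow_mul, hqp, mul_comm, pow_mul, pow_orderOf_eq_one, one_pow])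
      (fun h => by
        rw [← pow_mul, mul_comm, pow_mul] at h
        have h1 := hord ▸ orderOf_dvd_of_pow_eq_one h
        have h2 := hp.dvd_of_dvd_pow h1
        rw [Nat.prime_dvd_prime_iff_eq hp Nat.prime_two] at h2
        rw [h2] at hp2
        exact absurd hp2 (by decide))
    obtain ⟨t, ht⟩ := exists_conj_stabilizes_of_monomialNonvanishing hM f hfM hfL hx lam
    set s := t⁻¹ * x * t with hs
    -- `s` and `f s` differ by an element of the abelian group `M`, so they act alike on `M`.
    have hfs : ∀ m : M, lam (MulAut.conjNormal ((f s : L) : G) m) = lam m := by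
      intro m
      rw [← ht m]
      congr 1
      ext
      rw [MulAut.conjNormal_apply, MulAut.conjNormal_apply]
      have h1 : s * ((f s : L) : G)⁻¹ ∈ M := by
        rw [← hfM, MonoidHom.mem_ker, map_mul, map_inv, hfL, mul_inv_cancel]
      have h2 := hM _ h1 _ (hMn.conj_mem m m.2 (f s))
      have h3 := mul_inv_eq_of_eq_mul h2.eq
      rw [← h3]
      group
    have hpow : ∀ (j : ℕ) (m : M), lam (MulAut.conjNormal (((f s) ^ j : L) : G) m) = lam m := by
      intro j
      induction j with
      | zero => intro m; simp
      | succ j ih =>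
        intro m
        rw [pow_succ, Subgroup.coe_mul, map_mul, MulAut.mul_apply, ih, hfs]
    -- Conjugation by `(f t)⁻¹` turns the chosen power of `f x` into a power of `f s`, which fixes
    -- `lam`.
    obtain ⟨m, hm⟩ := hlam (f t)⁻¹
    refine hm ?_
    have h1 : (f t)⁻¹ * (f x ^ 2 ^ k) ^ q * (f t)⁻¹⁻¹ = f s ^ (2 ^ k * q) := by
      have h2 : f s = (f t)⁻¹ * f x * (f t)⁻¹⁻¹ := by rw [hs, map_mul, map_mul, map_inv, inv_inv]
      rw [h2, conj_pow, pow_mul]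
    rw [h1]
    exact hpow _ m

end Main

theorem mainTheorem4 (G : Type*) [Group G] [Finite G] [Group.IsSolvable G] :
    (∀ x ∈ monomialNonvanishing G,
      ∃ k : ℕ, orderOf (QuotientGroup.mk x : G ⧸ fittingSubgroup G) = 2 ^ k) ∧
    (Odd (Nat.card G) → monomialNonvanishing G ⊆ (fittingSubgroup G : Set G)) := by
  have key : ∀ x ∈ monomialNonvanishing G,
      ∃ k : ℕ, orderOf (QuotientGroup.mk x : G ⧸ fittingSubgroup G) = 2 ^ k := by
    intro x hx
    obtain ⟨k, hk⟩ := exists_pow_two_pow_mem_fittingSubgroup _ G rfl x hx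
    have h1 : (QuotientGroup.mk x : G ⧸ fittingSubgroup G) ^ 2 ^ k = 1 :=
      (QuotientGroup.eq_one_iff (x ^ 2 ^ k)).2 hk
    obtain ⟨j, -, hj⟩ := (Nat.dvd_prime_pow Nat.prime_two).1 (orderOf_dvd_of_pow_eq_one h1)
    exact ⟨j, hj⟩
  refine ⟨key, fun hodd x hx => ?_⟩
  obtain ⟨k, hk⟩ := key x hx
  have h1 : Odd (2 ^ k) := by
    refine hodd.of_dvd_nat ?_
    rw [← hk]
    exact (orderOf_dvd_natCard _).trans (Subgroup.card_quotient_dvd_card _)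
  rcases Nat.eq_zero_or_pos k with rfl | hk0
  · rw [pow_zero, orderOf_eq_one_iff, QuotientGroup.eq_one_iff] at hk
    exact hk
  · exact absurd h1 (Nat.not_odd_iff_even.2 ((Nat.even_pow' hk0.ne').2 even_two))
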